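/- **Setting.** Label the edges of a tetrahedron with vertices $z_1,\dots,z_4$ by $1=z_1z_3$, $2=z_1z_2$, $3=z_1z_4$, $4=z_2z_4$, $5=z_3z_4$, $6=z_2z_3$. Edge indices are read modulo $6$, so $i$ and $i+3$ are opposite edges. The triples of edges meeting at a vertex are $\{1,2,3\},\{3,4,5\},\{1,5,6\},\{2,4,6\}$, and the triangles are $\{1,2,6\},\{2,3,4\},\{1,3,5\},\{4,5,6\}$. For $s=(s_1,\dots,s_6)\in\mathbb Z^6$ and $\tau=\tau_1+i\tau_2$ in the upper half plane $\mathbb H$ put $$C_s(\tau)={\sum_{p_1,p_2,p_3}}'\ \prod_{j=1}^6\Big(\frac{\tau_2}{\pi|q_j|^2}\Big)^{s_j},\qquad (q_1,\dots,q_6)=(p_1,\;p_2,\;p_1+p_2,\;p_3,\;p_1+p_2+p_3,\;p_2+p_3),$$ where $p_1,p_2,p_3$ run over $\mathbb Z+\mathbb Z\tau$ and the prime means that all six $q_j$ are non-zero. The generating function of the tetrahedral modular graph functions is the formal power series $$\mathcal W(t_1,\dots,t_6)=\sum_{s_1,\dots,s_6\ge 1}t_1^{s_1-1}\cdots t_6^{s_6-1}\,C_s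 .$$ $\mathcal W|_{i\to c}$ denotes the same series with $s_i$ fixed to the value $c$ (no sum over $s_i$, no factor in $t_i$), and $\mathcal W|_{i,j\to0}$ the series with $s_i=s_j=0$ fixed. (A lattice sum in such a series that does not converge is given the value $0$; this value does not matter, as the derivatives in $\mathcal R$ remove these terms.) The Laplacian $\Delta=\tau_2^2(\partial_{\tau_1}^2+\partial_{\tau_2}^2)$ acts on the coefficients. Write $\partial_i=\partial/\partial t_i$, $\mathfrak D=\sum_{i=1}^6t_i\partial_i$, and $$\mathfrak M=\sum_{V_{ijk}}(t_i^2+t_j^2+t_k^2-2t_it_j-2t_jt_k-2t_kt_i)(\partial_i\partial_j+\partial_j\partial_k+\partial_k\partial_i)+\sum_{i=1}^3\big((t_{i+1}-t_{i+2}+t_{i+4}-t_{i+5})^2-4t_it_{i+3}\big)\partial_i\partial_{i+3},$$ where the first sum is over the four vertices, $V_{ijk}$ being the vertex with edges $i,j,k$. Put $\mathfrak C^2=\tfrac43\mathfrak D^2+2\mathfrak D+\mathfrak M$, and $$\begin{aligned}\mathcal R={}&-\sum_{i=1}^6\sum_{V_{pqi}}\big(\partial_p+\partial_q+(2t_p+2t_q-t_i)\partial_p\partial_q\big)\mathcal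 W|_{i\to0}\\ &+\sum_{i=1}^6\Big((t_i+2t_{i+3}-2t_{i+2}-2t_{i+5})\partial_{i+1}\partial_{i+4}+(t_i+2t_{i+3}-2t_{i+1}-2t_{i+4})\partial_{i+2}\partial_{i+5}\Big)\mathcal W|_{i\to0}\\ &+\sum_{i=1}^6(\partial_p+\partial_q)(\partial_r+\partial_s)\,\mathcal W|_{i\to-1}\\ &+\sum_{i=1}^3 2\,\partial_i\partial_{i+3}\Big(\mathcal W|_{i+1,i+4\to0}+\mathcal W|_{i+2,i+5\to0}-\mathcal W|_{i+1,i+2\to0}-\mathcal W|_{i+1,i+5\to0}-\mathcal W|_{i+2,i+4\to0}-\mathcal W|_{i+4,i+5\to0}\Big).\end{aligned}$$ In the first line the inner sum is over the two vertices at the ends of the edge $i$, with $p,q$ the two other edges at the vertex; in the third line $\{i,p,q\}$ and $\{i,r,s\}$ are the two triangles containing $i$. **Statement.** 1. The lattice sum $C_s(\tau)$ converges absolutely for every $\tau\in\mathbb H$ in each of the following cases: (a) all $s_j\ge1$; (b) one $s_i=0$, all others $\ge1$; (c) two of the $s_j$ are $0$, the others are $\ge1$, and $s_i,s_{i+3}\ge2$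 for some pair of opposite edges; (d) one $s_i=-1$, the others are $\ge1$, and each of the two triangles containing $i$ has an edge with exponent $\ge2$. (These are all the sums that enter below.) The coefficients of $\mathcal W$ are twice continuously differentiable on $\mathbb H$. 2. $\mathfrak C^2$ is the quadratic Casimir of split $\mathfrak{sl}(3)$: let $T$ be the symmetric $3\times3$ matrix of linear forms in the $t_i$ with $\ell_j^{\mathsf T}T\ell_j=t_j$ for all $j$, where $(\ell_1,\dots,\ell_6)=(e_1,\,e_2,\,e_1+e_2,\,e_3,\,e_1+e_2+e_3,\,e_2+e_3)$; let $\rho(X)$ be the derivation with $t_j\mapsto\ell_j^{\mathsf T}(X^{\mathsf T}T+TX)\ell_j$, and let $H_{ab}=\rho(E_{ab})-\tfrac13\delta_{ab}\sum_c\rho(E_{cc})$, where $E_{ab}$ are the matrix units. Then $\mathfrak C^2=\frac12\sum_{a,b}H_{ab}H_{ba}$ on formal power series. (On the representation with Dynkin labels $[p_1,p_2]$ this has the eigenvalue $\frac13(p_1^2+p_1p_2+p_2^2+3p_1+3p_2)$.) 3. The generating function satisfies the Laplace equation $$(\Delta-\mathfrak D^2+\mathfrak D+6)\,\mathcal W=\mathfrak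 M\,\mathcal W+\mathcal R ,$$ or equivalently $$\Big(\Delta-\mathfrak C^2+\tfrac13(\mathfrak D+3)(\mathfrak D+6)\Big)\mathcal W=\mathcal R .$$ -/

import Mathlib

open scoped UpperHalfPlane

noncomputable section

namespace Tetra

/-! Edges of the tetrahedron are `0, …, 5`, standing for the edges `1, …, 6`; `i` and `i + 3`
(modulo 6) are opposite edges. With the vertices called `z₁, …, z₄` the edges are
`1 = z₁z₃`, `2 = z₁z₂`, `3 = z₁z₄`, `4 = z₂z₄`, `5 = z₃z₄`, `6 = z₂z₃`. -/

/-- The three edges meeting at each of the four vertices: `123`, `345`, `156`, `246`. -/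
def vertexEdges : Fin 4 → Fin 3 → Fin 6 :=
  ![![0, 1, 2], ![2, 3, 4], ![0, 4, 5], ![1, 3, 5]]

/-- For an edge `i`, the two triangles `{i, p, q}` and `{i, r, s}` of the tetrahedron that contain
`i`, given as `((p, q), (r, s))`. The triangles are `126`, `234`, `135`, `456`. -/
def trianglesAt : Fin 6 → (Fin 6 × Fin 6) × (Fin 6 × Fin 6) :=
  ![((1, 5), (2, 4)), ((0, 5), (2, 3)), ((0, 4), (1, 3)),
    ((1, 2), (4, 5)), ((0, 2), (3, 5)), ((0, 1), (3, 4))]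

/-- The momenta `p₁, p₂, p₁ + p₂, p₃, p₁ + p₂ + p₃, p₂ + p₃` on the six edges; the pair `(m, n)`
stands for the momentum `m + n τ`. -/
def edgeMomentum (k : Fin 3 → ℤ × ℤ) : Fin 6 → ℤ × ℤ :=
  ![k 0, k 1, k 0 + k 1, k 2, k 0 + k 1 + k 2, k 1 + k 2]

/-- The index set of the primed sum: no edge carries zero momentum. -/
abbrev LoopMomenta : Type := {k : Fin 3 → ℤ × ℤ // ∀ j, edgeMomentum k j ≠ 0}

/-- The propagator `τ₂ / (π |m + n τ|²)`. -/
def propagator (τ : ℍ) (p : ℤ × ℤ) : ℝ :=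
  τ.im / (Real.pi * ‖(p.1 : ℂ) + (p.2 : ℂ) * (τ : ℂ)‖ ^ 2)

/-- The summand of the lattice sum with exponents `s`. -/
def latticeTerm (s : Fin 6 → ℤ) (τ : ℍ) (k : LoopMomenta) : ℝ :=
  ∏ j, propagator τ (edgeMomentum k.1 j) ^ s j

/-- The tetrahedral modular graph function with `s j` propagators on the edge `j`. -/
def modularGraphFn (s : Fin 6 → ℤ) (τ : ℍ) : ℝ :=
  ∑' k : LoopMomenta, latticeTerm s τ k

/-- The Laplacian `τ₂² (∂²/∂τ₁² + ∂²/∂τ₂²)` of the upper half plane. -/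
def hypLaplacian (f : ℍ → ℝ) (τ : ℍ) : ℝ :=
  τ.im ^ 2 * Laplacian.laplacian (f ∘ UpperHalfPlane.ofComplex) (τ : ℂ)

/-- Formal power series in `t₁, …, t₆` whose coefficients are functions of `τ`. -/
abbrev Series : Type := MvPowerSeries (Fin 6) (ℍ → ℝ)

/-- The Laplacian in `τ`, acting on each coefficient. -/
def seriesLaplacian (F : Series) : Series := fun n => hypLaplacian (MvPowerSeries.coeff n F)

/-- Generating function of (degenerate) tetrahedral graph functions. An edge `j` with `e j = none`
has its number of propagators `s_j` summed over `s_j ≥ 1` with weight `t_j ^ (s_j - 1)`; an edge with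
`e j = some c` carries the fixed number `c` of propagators and no variable. -/
def genFn (e : Fin 6 → Option ℤ) : Series := fun n τ =>
  open Classical in
  if ∀ j, e j ≠ none → n j = 0 then modularGraphFn (fun j => (e j).getD (n j + 1)) τ else 0

/-- The generating function of all tetrahedral modular graph functions. -/
def W : Series := genFn fun _ => none

/-- `W` with edge `i` set to the value `c`. -/
def W₁ (i : Fin 6) (c : ℤ) : Series := genFn (Function.update (fun _ => none) i (some c))

/-- `W` with the edges `i` and `j` set to the value `0`. -/
def W₀₀ (i j : Fin 6) : Series :=
  genFn (Function.update (Function.update (fun _ => none) i (some 0)) j (some 0))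

/-- Linear operators on power series; the product is composition. -/
abbrev Op : Type := Module.End ℝ Series

/-- The operator `∂/∂t_i`. -/
def pd (i : Fin 6) : Op :=
  ((MvPowerSeries.pderiv (ℍ → ℝ) i : Derivation _ _ _) : Series →ₗ[ℍ → ℝ] Series).restrictScalars ℝ

/-- The operator of multiplication by `t_i`. -/
def t (i : Fin 6) : Op := LinearMap.mulLeft ℝ (MvPowerSeries.X i : Series)

/-- The Euler operator `𝔇 = ∑ t_i ∂_i`. -/
def euler : Op := ∑ i, t i * pd i

/-- The part of the differential operator that comes from adjacent edges: for each vertex `V_{ijk}`,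
`(t_i² + t_j² + t_k² - 2 t_i t_j - 2 t_j t_k - 2 t_k t_i) (∂_i ∂_j + ∂_j ∂_k + ∂_k ∂_i)`. -/
def adjacentPart : Op :=
  ∑ v, let i := vertexEdges v 0; let j := vertexEdges v 1; let k := vertexEdges v 2
    (t i ^ 2 + t j ^ 2 + t k ^ 2 - 2 * t i * t j - 2 * t j * t k - 2 * t k * t i) *
      (pd i * pd j + pd j * pd k + pd k * pd i)

/-- The part of the differential operator that comes from the three pairs of opposite edges. -/
def oppositePart : Op :=
  ∑ i ∈ ({0, 1, 2} : Finset (Fin 6)),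
    ((t (i + 1) - t (i + 2) + t (i + 4) - t (i + 5)) ^ 2 - 4 * t i * t (i + 3)) *
      (pd i * pd (i + 3))

/-- The operator `𝔠²`. -/
def casimir : Op :=
  (4 / 3 : ℝ) • euler ^ 2 + 2 * euler + adjacentPart + oppositePart

/-- The coordinates `ℓ_j` of the six edge momenta in terms of the loop momenta: the variable `t_j`
is the value `ℓ_jᵀ T ℓ_j` of a quadratic form `T` in three variables. -/
def edgeVector : Fin 6 → Fin 3 → ℤ :=
  ![![1, 0, 0], ![0, 1, 0], ![1, 1, 0], ![0, 0, 1], ![1, 1, 1], ![0, 1, 1]]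

/-- Multiplication by the entries of `2 T`, where `T` is the symmetric `3 × 3` matrix of linear forms
in the `t_i` such that `ℓ_jᵀ T ℓ_j = t_j` for each edge `j`. -/
def twoT : Matrix (Fin 3) (Fin 3) Op :=
  !![2 * t 0, t 2 - t 0 - t 1, t 1 + t 4 - t 2 - t 5;
     t 2 - t 0 - t 1, 2 * t 1, t 5 - t 1 - t 3;
     t 1 + t 4 - t 2 - t 5, t 5 - t 1 - t 3, 2 * t 3]

/-- The vector field on the space of the `T` that gives the infinitesimal action
`T ↦ Eᵀ T + T E` of the matrix unit `E = E_{ab}`: it maps `t_j = ℓ_jᵀ T ℓ_j` to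
`ℓ_jᵀ (Eᵀ T + T E) ℓ_j = (ℓ_j)_b ∑_c 2 T_{ac} (ℓ_j)_c`. -/
def glAction (a b : Fin 3) : Op :=
  ∑ j, ∑ c, (edgeVector j b * edgeVector j c) • (twoT a c * pd j)

/-- The action of the traceless part of the matrix unit `E_{ab}`; these span `sl(3)`. -/
def slAction (a b : Fin 3) : Op :=
  glAction a b - if a = b then (1 / 3 : ℝ) • ∑ c, glAction c c else 0

/-- The quadratic Casimir of split `sl(3)` in this action, normalised to have the eigenvalue
`(p₁² + p₁ p₂ + p₂² + 3 p₁ + 3 p₂) / 3` on the representation with Dynkin labels `[p₁, p₂]`. -/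
def slCasimir : Op := (1 / 2 : ℝ) • ∑ a, ∑ b, slAction a b * slAction b a

/-- The terms of the remainder with one edge set to `0` that come from adjacent edges: for each edge
`i` and each of the two vertices `V_{pqi}` at its ends. -/
def remainderAdjacent : Series :=
  - ∑ v, ∑ a : Fin 3,
    let i := vertexEdges v a; let p := vertexEdges v (a + 1); let q := vertexEdges v (a + 2)
    (pd p + pd q + (2 * t p + 2 * t q - t i) * (pd p * pd q)) (W₁ i 0)

/-- The terms of the remainder with one edge `i` set to `0` that come from the two pairs of opposite
edges not containing `i`. -/
def remainderOpposite : Series :=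
  ∑ i : Fin 6,
    ((t i + 2 * t (i + 3) - 2 * t (i + 2) - 2 * t (i + 5)) * (pd (i + 1) * pd (i + 4)) +
      (t i + 2 * t (i + 3) - 2 * t (i + 1) - 2 * t (i + 4)) * (pd (i + 2) * pd (i + 5))) (W₁ i 0)

/-- The terms of the remainder with one edge set to `-1`. -/
def remainderNegOne : Series :=
  ∑ i : Fin 6,
    let p := (trianglesAt i).1.1; let q := (trianglesAt i).1.2
    let r := (trianglesAt i).2.1; let s := (trianglesAt i).2.2
    ((pd p + pd q) * (pd r + pd s)) (W₁ i (-1))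

/-- The terms of the remainder with two edges set to `0`: opposite ones have sign `+`, adjacent ones
have sign `-`. -/
def remainderTwoZero : Series :=
  ∑ i ∈ ({0, 1, 2} : Finset (Fin 6)),
    (2 * (pd i * pd (i + 3)))
      (W₀₀ (i + 1) (i + 4) + W₀₀ (i + 2) (i + 5) - W₀₀ (i + 1) (i + 2) - W₀₀ (i + 1) (i + 5)
        - W₀₀ (i + 2) (i + 4) - W₀₀ (i + 4) (i + 5))

/-- The remainder `ℛ`. -/
def remainder : Series :=
  remainderAdjacent + remainderOpposite + remainderNegOne + remainderTwoZero

/-- The exponents of the lattice sums that enter the Laplace equation: all edges at least `1`; or one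
edge `0` and the others at least `1`; or two edges `0`, the others at least `1`, and at least `2` on
a pair of opposite edges; or one edge `i` equal to `-1`, the others at least `1`, and in each of the
two triangles that contain `i` at least one exponent that is at least `2`. -/
def Occurs (s : Fin 6 → ℤ) : Prop :=
  (∀ j, 1 ≤ s j) ∨
  (∃ i, s i = 0 ∧ ∀ j, j ≠ i → 1 ≤ s j) ∨
  (∃ i j k, j ≠ k ∧ s j = 0 ∧ s k = 0 ∧ 2 ≤ s i ∧ 2 ≤ s (i + 3) ∧
    ∀ l, l ≠ j → l ≠ k → 1 ≤ s l) ∨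
  (∃ i, s i = -1 ∧ (∀ j, j ≠ i → 1 ≤ s j) ∧
    (2 ≤ s (trianglesAt i).1.1 ∨ 2 ≤ s (trianglesAt i).1.2) ∧
    (2 ≤ s (trianglesAt i).2.1 ∨ 2 ≤ s (trianglesAt i).2.2))

end Tetra

end

noncomputable section

namespace Tetra

/-! ### Absolute convergence of the majorant -/

section

/-! Write `X_j` for the inverse propagator of the edge `j`, so that a lattice summand is `∏ X_j ^
(-s_j)`. Two facts hold for each momentum: `τ₂² Δ X = 2 X` for the Euclidean Laplacian `Δ`, and `τ₂²
|∇X|² = X²`. Hence the hyperbolic Laplacian multiplies a summand by `∑ s_i s_j G_ij / (X_i X_j) - ∑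
s_j`, where `G_ij` is `τ₂²` times the scalar product of the gradients (`laplacian_realTerm`).
Momentum conservation makes `2 G_ij` a quadratic polynomial in the `X`: two edges at a vertex
involve the third edge there, two opposite edges involve all six (`two_mul_gradPairing_vertex`,
`two_mul_gradPairing_opposite`).

On generating functions the factor `s_i s_j / (X_i X_j)` is `∂_i ∂_j`, and multiplication by `X_i`
lowers `s_i`, that is, it multiplies by `t_i` and adds a boundary series in which the edge `i` has
exponent `0` (`gen_lower_of_none`). Commuting the `t_i` to the left of the derivatives gives `𝔇² - 𝔇
- 6 + 𝔐`, and the boundary series make up the remainder (`lapSeries_modularGraphFn`). This step is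
formal and valid for arbitrary coefficients, so the values given to divergent sums play no role in
it.

The analysis needed is summation term by term. The summand is homogeneous in each edge momentum
separately, so compactness bounds its `τ`-derivatives up to order two by `∏ |q_j| ^ (-2 s_j)`
(`exists_iteratedFDeriv_cutTerm_le`). That majorant is summable for all exponents that occur
(`Occurs.summable_normTerm`), so both the Laplacian and the splitting into shifted sums commute with
the lattice sum (`seriesLaplacian_W`). The Casimir statement is an identity of second-order
operators with polynomial coefficients, checked by normal ordering (`sum_glAction_mul`). -/

/-- Three edges whose momenta are linearly independent, i.e. which do not meet at a vertex. -/
def IndepEdges (a b c : Fin 6) : Prop :=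
  (Matrix.of ![edgeVector a, edgeVector b, edgeVector c]).det ≠ 0

instance (a b c : Fin 6) : Decidable (IndepEdges a b c) := by
  unfold IndepEdges; infer_instance

theorem edgeMomentum_fst (k : Fin 3 → ℤ × ℤ) (j : Fin 6) :
    (edgeMomentum k j).1 = edgeVector j ⬝ᵥ fun c => (k c).1 := by
  fin_cases j <;> simp [edgeMomentum, edgeVector, dotProduct, Fin.sum_univ_three]

theorem edgeMomentum_snd (k : Fin 3 → ℤ × ℤ) (j : Fin 6) :
    (edgeMomentum k j).2 = edgeVector j ⬝ᵥ fun c => (k c).2 := by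
  fin_cases j <;> simp [edgeMomentum, edgeVector, dotProduct, Fin.sum_univ_three]

/-- An integer matrix with non-zero determinant has trivial kernel, so three independent edge
momenta determine the loop momenta, component by component. -/
theorem IndepEdges.injective {a b c : Fin 6} (h : IndepEdges a b c) :
    Function.Injective fun k : Fin 3 → ℤ × ℤ =>
      (edgeMomentum k a, edgeMomentum k b, edgeMomentum k c) := by
  intro k l hkl
  simp only [Prod.mk.injEq] at hkl
  obtain ⟨ha, hb, hc⟩ := hkl
  have key : ∀ f g : Fin 3 → ℤ, edgeVector a ⬝ᵥ f = edgeVector a ⬝ᵥ g →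
      edgeVector b ⬝ᵥ f = edgeVector b ⬝ᵥ g → edgeVector c ⬝ᵥ f = edgeVector c ⬝ᵥ g → f = g := by
    intro f g h1 h2 h3
    rw [← sub_eq_zero]
    refine Matrix.eq_zero_of_mulVec_eq_zero h ?_
    rw [Matrix.mulVec_sub, sub_eq_zero]
    ext i
    fin_cases i
    · exact h1
    · exact h2
    · exact h3
  have h1 := key (fun c => (k c).1) (fun c => (l c).1)
    (by rw [← edgeMomentum_fst, ← edgeMomentum_fst, ha])
    (by rw [← edgeMomentum_fst, ← edgeMomentum_fst, hb])
    (by rw [← edgeMomentum_fst, ← edgeMomentum_fst, hc])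
  have h2 := key (fun c => (k c).2) (fun c => (l c).2)
    (by rw [← edgeMomentum_snd, ← edgeMomentum_snd, ha])
    (by rw [← edgeMomentum_snd, ← edgeMomentum_snd, hb])
    (by rw [← edgeMomentum_snd, ← edgeMomentum_snd, hc])
  funext i
  exact Prod.ext (congrFun h1 i) (congrFun h2 i)

theorem summable_norm_inv_pow_three : Summable fun p : ℤ × ℤ => ‖p‖⁻¹ ^ 3 := by
  have h := (finTwoArrowEquiv ℤ).symm.summable_iff.mpr
    (EisensteinSeries.summable_one_div_norm_rpow (k := 3) (by norm_num))
  refine h.congr fun p => ?_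
  have : ‖(finTwoArrowEquiv ℤ).symm p‖ = ‖p‖ := by
    rw [EisensteinSeries.norm_eq_max_natAbs, Prod.norm_def, Int.norm_eq_abs, Int.norm_eq_abs]
    simp [Nat.cast_natAbs]
  rw [Function.comp_apply, this, Real.rpow_neg (norm_nonneg _), inv_pow]
  norm_cast

/-- The reciprocal of the sup norm of the momentum on the edge `j`. -/
def invNorm (k : LoopMomenta) (j : Fin 6) : ℝ := ‖edgeMomentum k.1 j‖⁻¹

theorem one_le_norm_of_ne_zero {p : ℤ × ℤ} (hp : p ≠ 0) : 1 ≤ ‖p‖ := by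
  rw [Prod.norm_def, Int.norm_eq_abs, Int.norm_eq_abs]
  by_contra! h
  rw [max_lt_iff] at h
  refine hp (Prod.ext ?_ ?_)
  · exact Int.abs_lt_one_iff.mp (by exact_mod_cast h.1)
  · exact Int.abs_lt_one_iff.mp (by exact_mod_cast h.2)

theorem invNorm_pos (k : LoopMomenta) (j : Fin 6) : 0 < invNorm k j :=
  inv_pos.mpr (norm_pos_iff.mpr (k.2 j))

theorem invNorm_le_one (k : LoopMomenta) (j : Fin 6) : invNorm k j ≤ 1 :=
  inv_le_one_of_one_le₀ (one_le_norm_of_ne_zero (k.2 j))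

/-- Injectivity bounds the sum by the cube of `∑ ‖p‖⁻³` over `ℤ²`, which is finite because `3 > 2`.
All the convergence proofs reduce to this one. -/
theorem IndepEdges.summable {a b c : Fin 6} (h : IndepEdges a b c) :
    Summable fun k : LoopMomenta => invNorm k a ^ 3 * invNorm k b ^ 3 * invNorm k c ^ 3 := by
  have h1 := summable_norm_inv_pow_three
  have h2 := h1.mul_of_nonneg (h1.mul_of_nonneg h1 (fun _ => by positivity)
    (fun _ => by positivity)) (fun _ => by positivity) (fun _ => by positivity)
  refine (h2.comp_injective (h.injective.comp Subtype.val_injective)).congr fun k => ?_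
  simp only [Function.comp_apply, invNorm, mul_assoc]

/-- The product of the norms of the edge momenta that dominates the lattice summand. -/
def normTerm (s : Fin 6 → ℤ) (k : LoopMomenta) : ℝ := ∏ j, invNorm k j ^ (2 * s j)

theorem normTerm_pos (s : Fin 6 → ℤ) (k : LoopMomenta) : 0 < normTerm s k :=
  Finset.prod_pos fun j _ => zpow_pos (invNorm_pos k j) _

theorem prod_univ_le_prod_of_le_one {ι : Type*} [Fintype ι] [DecidableEq ι] (S : Finset ι)
    {v w : ι → ℝ} (h0 : ∀ j, 0 ≤ v j) (h1 : ∀ j, v j ≤ 1) (h : ∀ j ∈ S, v j ≤ w j) :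
    ∏ j, v j ≤ ∏ j ∈ S, w j := by
  rw [← Finset.prod_mul_prod_compl S v]
  calc _ ≤ (∏ j ∈ S, w j) * 1 := by
        refine mul_le_mul (Finset.prod_le_prod (fun j _ => h0 j) h)
          (Finset.prod_le_one (fun j _ => h0 j) fun j _ => h1 j)
          (Finset.prod_nonneg fun j _ => h0 j) (Finset.prod_nonneg fun j hj => (h0 j).trans (h j hj))
    _ = _ := mul_one _

theorem invNorm_zpow_le (k : LoopMomenta) (j : Fin 6) {m : ℕ} {n : ℤ} (h : (m : ℤ) ≤ n) :
    invNorm k j ^ n ≤ invNorm k j ^ m := by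
  rw [← zpow_natCast]
  exact zpow_le_zpow_right_of_le_one₀ (invNorm_pos k j) (invNorm_le_one k j) h

/-- Each `invNorm` is at most `1`, so factors may be dropped and exponents lowered as long as all
exponents are non-negative. -/
theorem normTerm_le_prod (s : Fin 6 → ℤ) (hs : ∀ j, 0 ≤ s j) (k : LoopMomenta) (S : Finset (Fin 6))
    (e : Fin 6 → ℕ) (he : ∀ j ∈ S, (e j : ℤ) ≤ 2 * s j) :
    normTerm s k ≤ ∏ j ∈ S, invNorm k j ^ e j := by
  refine prod_univ_le_prod_of_le_one S (fun j => (zpow_pos (invNorm_pos k j) _).le) (fun j => ?_)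
    fun j hj => invNorm_zpow_le k j (he j hj)
  simpa using invNorm_zpow_le k j (m := 0) (n := 2 * s j) (by have := hs j; push_cast; omega)

/-- The left side is the geometric mean of `o⁶a³c³`, `a³b³d³` and `b³c³d³`, hence at most their
maximum; `o ≤ 1` then replaces `o⁶` by `o³`. -/
theorem prod_five_le_sum {o a b c d : ℝ} (ho : 0 < o) (ha : 0 < a) (hb : 0 < b) (hc : 0 < c)
    (hd : 0 < d) (ho1 : o ≤ 1) :
    o ^ 2 * a ^ 2 * b ^ 2 * c ^ 2 * d ^ 2 ≤
      o ^ 3 * a ^ 3 * c ^ 3 + a ^ 3 * b ^ 3 * d ^ 3 + b ^ 3 * c ^ 3 * d ^ 3 := by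
  by_contra! h
  set P := o ^ 2 * a ^ 2 * b ^ 2 * c ^ 2 * d ^ 2 with hP
  -- With `o⁶` in place of `o³` the product of the three bounds is exactly `P ^ 3`, which
  -- contradicts all three being smaller than `P`.
  have hA : o ^ 6 * a ^ 3 * c ^ 3 < P := by
    have : o ^ 6 ≤ o ^ 3 := pow_le_pow_of_le_one ho.le ho1 (by norm_num)
    have : o ^ 6 * a ^ 3 * c ^ 3 ≤ o ^ 3 * a ^ 3 * c ^ 3 := by gcongr
    have : 0 < a ^ 3 * b ^ 3 * d ^ 3 := by positivity
    have : 0 < b ^ 3 * c ^ 3 * d ^ 3 := by positivity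
    linarith
  have h1 : 0 < o ^ 3 * a ^ 3 * c ^ 3 := by positivity
  have h2 : 0 < a ^ 3 * b ^ 3 * d ^ 3 := by positivity
  have h3 : 0 < b ^ 3 * c ^ 3 * d ^ 3 := by positivity
  have hB : a ^ 3 * b ^ 3 * d ^ 3 < P := by linarith
  have hC : b ^ 3 * c ^ 3 * d ^ 3 < P := by linarith
  have hP0 : 0 < P := by positivity
  have hAB := mul_lt_mul'' hA hB (by positivity) h2.le
  have hABC := mul_lt_mul'' hAB hC (by positivity) h3.le
  refine absurd hABC (not_lt.mpr (le_of_eq ?_))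
  rw [hP]; ring

/-- The five edges other than `i` already suffice: three triples among them are independent, and
`prod_five_le_sum` distributes the squares over these triples. -/
theorem summable_normTerm_of_one (s : Fin 6 → ℤ) (i : Fin 6) (hi : 0 ≤ s i)
    (h : ∀ j, j ≠ i → 1 ≤ s j) : Summable (normTerm s) := by
  have hs : ∀ j, 0 ≤ s j := fun j => by
    by_cases hj : j = i
    · rwa [hj]
    · have := h j hj; omega
  have key : ∀ o a b c d : Fin 6, (∀ j ∈ [o, a, b, c, d], j ≠ i) → [o, a, b, c, d].Nodup →
      IndepEdges o a c → IndepEdges a b d → IndepEdges b c d → Summable (normTerm s) := by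
    intro o a b c d hmem hnd h1 h2 h3
    refine Summable.of_nonneg_of_le (fun k => (normTerm_pos s k).le) (fun k => ?_)
      ((h1.summable.add h2.summable).add h3.summable)
    refine le_trans (normTerm_le_prod s hs k ⟨[o, a, b, c, d], hnd⟩ (fun _ => 2)
      fun j hj => ?_) ?_
    · have := h j (hmem j hj)
      push_cast; omega
    · refine le_trans (le_of_eq ?_) (prod_five_le_sum (invNorm_pos k o) (invNorm_pos k a)
        (invNorm_pos k b) (invNorm_pos k c) (invNorm_pos k d) (invNorm_le_one k o))
      simp [Finset.prod, mul_assoc]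
  -- In each case `o` is the edge opposite to `i`, and none of the three triples meets at a vertex.
  fin_cases i
  · exact key 3 1 5 2 4 (by decide) (by decide) (by decide) (by decide) (by decide)
  · exact key 4 0 5 2 3 (by decide) (by decide) (by decide) (by decide) (by decide)
  · exact key 5 0 4 1 3 (by decide) (by decide) (by decide) (by decide) (by decide)
  · exact key 0 1 2 4 5 (by decide) (by decide) (by decide) (by decide) (by decide)
  · exact key 1 0 2 3 5 (by decide) (by decide) (by decide) (by decide) (by decide)
  · exact key 2 0 1 3 4 (by decide) (by decide) (by decide) (by decide) (by decide)

/-- A pair of opposite edges is independent of any third edge. The pair supplies two cubes, and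
`x²y² ≤ max(x, y)⁴ ≤ x³ + y³` supplies the third. -/
theorem summable_normTerm_of_two (s : Fin 6 → ℤ) (hs : ∀ j, 0 ≤ s j) (i a c : Fin 6)
    (hnd : [i, i + 3, a, c].Nodup) (hi : 2 ≤ s i) (hi' : 2 ≤ s (i + 3)) (ha : 1 ≤ s a)
    (hc : 1 ≤ s c) : Summable (normTerm s) := by
  have indep : ∀ i a : Fin 6, [i, i + 3, a].Nodup → IndepEdges i (i + 3) a := by decide
  have h1 := (indep i a (hnd.sublist (by simp))).summable
  have h2 := (indep i c (hnd.sublist (by simp))).summable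
  refine Summable.of_nonneg_of_le (fun k => (normTerm_pos s k).le) (fun k => ?_) (h1.add h2)
  refine le_trans (normTerm_le_prod s hs k ⟨[i, i + 3, a, c], hnd⟩
    (fun j => if j = i ∨ j = i + 3 then 3 else 2) fun j hj => ?_) ?_
  · have hj' : j = i ∨ j = i + 3 ∨ j = a ∨ j = c := by
      have : j ∈ [i, i + 3, a, c] := hj
      simpa using this
    rcases hj' with rfl | rfl | rfl | rfl
    · simp; omega
    · simp; omega
    · split_ifs with h
      · rcases h with h | h <;> · rw [h]; push_cast; omega
      · push_cast; omega
    · split_ifs with h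
      · rcases h with h | h <;> · rw [h]; push_cast; omega
      · push_cast; omega
  · have hai : a ≠ i ∧ a ≠ i + 3 ∧ c ≠ i ∧ c ≠ i + 3 := by
      simp only [List.nodup_cons, List.mem_cons, not_or] at hnd
      tauto
    simp only [Finset.prod, Multiset.map_coe, List.map_cons, List.map_nil, Multiset.prod_coe,
      List.prod_cons, List.prod_nil, mul_one, true_or, or_true, if_true, hai.1, hai.2.1, hai.2.2.1,
      hai.2.2.2, or_self, if_false]
    have hu := invNorm_pos k i
    have hv := invNorm_pos k (i + 3)
    have hx := invNorm_pos k a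
    have hy := invNorm_pos k c
    have hx1 := invNorm_le_one k a
    have hy1 := invNorm_le_one k c
    generalize invNorm k i = u at *
    generalize invNorm k (i + 3) = v at *
    generalize invNorm k a = x at *
    generalize invNorm k c = y at *
    have hxy : x ^ 2 * y ^ 2 ≤ x ^ 3 + y ^ 3 := by
      rcases le_total x y with h | h
      · calc x ^ 2 * y ^ 2 ≤ y ^ 2 * y ^ 2 := by gcongr
          _ = y ^ 3 * y := by ring
          _ ≤ y ^ 3 * 1 := by gcongr
          _ ≤ _ := by have : 0 < x ^ 3 := by positivity
                      linarith
      · calc x ^ 2 * y ^ 2 ≤ x ^ 2 * x ^ 2 := by gcongr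
          _ = x ^ 3 * x := by ring
          _ ≤ x ^ 3 * 1 := by gcongr
          _ ≤ _ := by have : 0 < y ^ 3 := by positivity
                      linarith
    calc u ^ 3 * (v ^ 3 * (x ^ 2 * y ^ 2)) ≤ u ^ 3 * (v ^ 3 * (x ^ 3 + y ^ 3)) := by gcongr
      _ = _ := by ring

theorem normTerm_update {s s' : Fin 6 → ℤ} (i p : Fin 6) (hip : i ≠ p) (hi : s' i = s i + 1)
    (hp : s' p = s p - 1) (h : ∀ j, j ≠ i → j ≠ p → s' j = s j) (k : LoopMomenta) :
    normTerm s' k = normTerm s k * (invNorm k i ^ 2 * (invNorm k p ^ 2)⁻¹) := by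
  have hprod : (∏ j, if j = i then invNorm k i ^ (2 : ℤ) else 1) *
      ∏ j, (if j = p then invNorm k p ^ (-2 : ℤ) else 1) =
        invNorm k i ^ 2 * (invNorm k p ^ 2)⁻¹ := by
    simp only [Finset.prod_ite_eq', Finset.mem_univ, if_true, zpow_neg]
    norm_cast
  rw [← hprod, ← Finset.prod_mul_distrib, normTerm, normTerm, ← Finset.prod_mul_distrib]
  refine Finset.prod_congr rfl fun j _ => ?_
  have hj := (invNorm_pos k j).ne'
  by_cases h1 : j = i
  · subst h1
    rw [if_pos rfl, if_neg hip, hi, mul_one, ← zpow_add₀ hj]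
    ring_nf
  · by_cases h2 : j = p
    · subst h2
      rw [if_neg h1, if_pos rfl, hp, one_mul, ← zpow_add₀ hj]
      ring_nf
    · rw [if_neg h1, if_neg h2, h j h1 h2, mul_one, mul_one]

/-- From `‖q_i‖ ≤ ‖q_p‖ + ‖q_q‖` follows `‖q_i‖² ≤ 2 (‖q_p‖² + ‖q_q‖²)`: a numerator on `i` is
traded for a numerator on `p` or on `q`. -/
theorem summable_normTerm_of_le {s s₁ s₂ : Fin 6 → ℤ} (i p q : Fin 6) (hip : i ≠ p) (hiq : i ≠ q)
    (hi₁ : s₁ i = s i + 1) (hp₁ : s₁ p = s p - 1) (h₁ : ∀ j, j ≠ i → j ≠ p → s₁ j = s j)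
    (hi₂ : s₂ i = s i + 1) (hp₂ : s₂ q = s q - 1) (h₂ : ∀ j, j ≠ i → j ≠ q → s₂ j = s j)
    (hnorm : ∀ k : Fin 3 → ℤ × ℤ,
      ‖edgeMomentum k i‖ ≤ ‖edgeMomentum k p‖ + ‖edgeMomentum k q‖)
    (hs₁ : Summable (normTerm s₁)) (hs₂ : Summable (normTerm s₂)) : Summable (normTerm s) := by
  refine Summable.of_nonneg_of_le (fun k => (normTerm_pos s k).le) (fun k => ?_)
    ((hs₁.add hs₂).mul_left 2)
  rw [normTerm_update i p hip hi₁ hp₁ h₁, normTerm_update i q hiq hi₂ hp₂ h₂, ← mul_add,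
    mul_left_comm]
  refine le_mul_of_one_le_right (normTerm_pos s k).le ?_
  have hn := hnorm k.1
  have hi0 := norm_pos_iff.mpr (k.2 i)
  have hp0 := norm_pos_iff.mpr (k.2 p)
  have hq0 := norm_pos_iff.mpr (k.2 q)
  simp only [invNorm, inv_pow, inv_inv]
  rw [← mul_add, ← div_eq_inv_mul, ← mul_div_assoc, one_le_div (by positivity)]
  nlinarith [sq_nonneg (‖edgeMomentum k.1 p‖ - ‖edgeMomentum k.1 q‖)]

/-- The exponents after the trade of a numerator from `i` to `p`. Either `p` keeps a positive
exponent, or it may vanish together with `i` and the opposite pair `x`, `x + 3` ensures convergence.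
-/
theorem summable_normTerm_of_reduce {s : Fin 6 → ℤ} (i p x a c : Fin 6)
    (hnd : [i, p, x, x + 3, a, c].Nodup) (hi : s i = -1) (h : ∀ j, j ≠ i → 1 ≤ s j)
    (h2 : 2 ≤ s p ∨ (2 ≤ s x ∧ 2 ≤ s (x + 3))) :
    Summable (normTerm (Function.update (Function.update s i 0) p (s p - 1))) := by
  simp only [List.nodup_cons, List.mem_cons, not_or, List.not_mem_nil, not_false_eq_true,
    List.nodup_nil, and_true] at hnd
  obtain ⟨⟨hip, hix, hix3, hia, hic⟩, ⟨hpx, hpx3, hpa, hpc⟩, ⟨hxx3, hxa, hxc⟩, ⟨hx3a, hx3c⟩, hac⟩ :=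
    hnd
  have hp := h p (Ne.symm hip)
  rcases h2 with h2 | ⟨h2, h3⟩
  · refine summable_normTerm_of_one _ i (by simp [hip]) fun j hj => ?_
    by_cases hjp : j = p
    · subst hjp; simp; omega
    · simpa [hj, hjp] using h j hj
  · refine summable_normTerm_of_two _ (fun j => ?_) x a c
      (by simp [hxx3, hxa, hxc, hx3a, hx3c, hac]) ?_ ?_ ?_ ?_
    · by_cases hjp : j = p
      · subst hjp; simp; omega
      · by_cases hj : j = i
        · subst hj; simp [hip]
        · have := h j hj
          simp [hj, hjp]; omega
    · simpa [Ne.symm hix, Ne.symm hpx] using h2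
    · simpa [Ne.symm hix3, Ne.symm hpx3] using h3
    · simpa [Ne.symm hia, Ne.symm hpa] using h a (Ne.symm hia)
    · simpa [Ne.symm hic, Ne.symm hpc] using h c (Ne.symm hic)

theorem summable_normTerm_of_negOne_aux {s : Fin 6 → ℤ} (i p q : Fin 6)
    (hnd : [i, i + 3, p, p + 3, q, q + 3].Nodup) (hi : s i = -1) (h : ∀ j, j ≠ i → 1 ≤ s j)
    (hnorm : ∀ k : Fin 3 → ℤ × ℤ,
      ‖edgeMomentum k i‖ ≤ ‖edgeMomentum k p‖ + ‖edgeMomentum k q‖)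
    (h1 : 2 ≤ s p ∨ (2 ≤ s q ∧ 2 ≤ s (q + 3))) (h2 : 2 ≤ s q ∨ (2 ≤ s p ∧ 2 ≤ s (p + 3))) :
    Summable (normTerm s) := by
  have e1 : [i, i + 3, p, p + 3, q, q + 3].Perm [i, p, q, q + 3, i + 3, p + 3] := by
    refine List.Perm.cons _ ?_
    rw [List.perm_iff_count]
    intro a
    simp only [List.count_cons, List.count_nil]
    omega
  have e2 : [i, i + 3, p, p + 3, q, q + 3].Perm [i, q, p, p + 3, i + 3, q + 3] := by
    refine List.Perm.cons _ ?_
    rw [List.perm_iff_count]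
    intro a
    simp only [List.count_cons, List.count_nil]
    omega
  have s1 := summable_normTerm_of_reduce i p q (i + 3) (p + 3) (e1.nodup_iff.mp hnd) hi h h1
  have s2 := summable_normTerm_of_reduce i q p (i + 3) (q + 3) (e2.nodup_iff.mp hnd) hi h h2
  simp only [List.nodup_cons, List.mem_cons, not_or] at hnd
  obtain ⟨⟨-, hip, -, hiq, -⟩, -⟩ := hnd
  refine summable_normTerm_of_le i p q hip hiq ?_ ?_ ?_ ?_ ?_ ?_ hnorm s1 s2
  · simp [hip, hi]
  · simp
  · intro j h1 h2; simp [h1, h2]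
  · simp [hiq, hi]
  · simp
  · intro j h1 h2; simp [h1, h2]

/-- Momentum conservation at a vertex: up to signs, each of the three momenta is the sum of the
other two. -/
theorem edgeMomentum_norm_le (k : Fin 3 → ℤ × ℤ) (v : Fin 4) (a : Fin 3) :
    ‖edgeMomentum k (vertexEdges v a)‖ ≤
      ‖edgeMomentum k (vertexEdges v (a + 1))‖ + ‖edgeMomentum k (vertexEdges v (a + 2))‖ := by
  have key : ∀ x y z : ℤ × ℤ, (x = y + z ∨ x = y - z ∨ x = z - y) → ‖x‖ ≤ ‖y‖ + ‖z‖ := by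
    rintro x y z (rfl | rfl | rfl)
    · exact norm_add_le _ _
    · exact norm_sub_le _ _
    · rw [add_comm]; exact norm_sub_le _ _
  apply key
  fin_cases v <;> fin_cases a <;> simp [vertexEdges, edgeMomentum] <;> grind

/-- The ends of `i` are the vertices `{i, p, q}` and `{i, p+3, q+3}`, while its triangles are `{i,
p, q+3}` and `{i, q, p+3}`. The two triangle conditions always allow the numerator to be moved at
one of the two ends. -/
theorem summable_normTerm_of_negOne {s : Fin 6 → ℤ} (i : Fin 6) (hi : s i = -1)
    (h : ∀ j, j ≠ i → 1 ≤ s j)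
    (h1 : 2 ≤ s (trianglesAt i).1.1 ∨ 2 ≤ s (trianglesAt i).1.2)
    (h2 : 2 ≤ s (trianglesAt i).2.1 ∨ 2 ≤ s (trianglesAt i).2.2) : Summable (normTerm s) := by
  have key : ∀ (v w : Fin 4) (a b : Fin 3), vertexEdges v a = i → vertexEdges w b = i →
      ∀ p q, vertexEdges v (a + 1) = p → vertexEdges v (a + 2) = q →
      (vertexEdges w (b + 1) = p + 3 ∧ vertexEdges w (b + 2) = q + 3 ∨
        vertexEdges w (b + 1) = q + 3 ∧ vertexEdges w (b + 2) = p + 3) →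
      [i, i + 3, p, p + 3, q, q + 3].Nodup →
      [i, i + 3, p + 3, p + 3 + 3, q + 3, q + 3 + 3].Nodup → p + 3 + 3 = p → q + 3 + 3 = q →
      (2 ≤ s p ∨ 2 ≤ s (q + 3)) → (2 ≤ s q ∨ 2 ≤ s (p + 3)) → Summable (normTerm s) := by
    intro v w a b hv hw p q hp hq hpq hnd hnd' ep eq g1 g2
    have n1 := fun k => edgeMomentum_norm_le k v a
    have n2 : ∀ k, ‖edgeMomentum k i‖ ≤ ‖edgeMomentum k (p + 3)‖ + ‖edgeMomentum k (q + 3)‖ := by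
      intro k
      have := edgeMomentum_norm_le k w b
      rcases hpq with ⟨hp', hq'⟩ | ⟨hq', hp'⟩ <;> rw [hw, hp', hq'] at this <;> linarith
    rw [hv, hp, hq] at n1
    -- If both edges `p + 3`, `q + 3` have room, the trade is made at that vertex. Otherwise one of
    -- them has exponent below `2`, and the triangle conditions supply what the trade at the vertex
    -- of `p`, `q` needs.
    by_cases g : 2 ≤ s (p + 3) ∧ 2 ≤ s (q + 3)
    · exact summable_normTerm_of_negOne_aux i (p + 3) (q + 3) hnd' hi h n2 (Or.inl g.1)
        (Or.inl g.2)
    · exact summable_normTerm_of_negOne_aux i p q hnd hi h n1 (by tauto) (by tauto)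
  fin_cases i
  · exact key 0 2 0 0 rfl rfl 1 2 rfl rfl (by decide) (by decide) (by decide) rfl rfl h1 h2
  · exact key 0 3 1 0 rfl rfl 2 0 rfl rfl (by decide) (by decide) (by decide) rfl rfl h2 h1
  · exact key 0 1 2 0 rfl rfl 0 1 rfl rfl (by decide) (by decide) (by decide) rfl rfl h1 h2
  · exact key 1 3 1 1 rfl rfl 4 2 rfl rfl (by decide) (by decide) (by decide) rfl rfl h2 h1.symm
  · exact key 1 2 2 1 rfl rfl 2 3 rfl rfl (by decide) (by decide) (by decide) rfl rfl h1.symm h2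
  · exact key 2 3 2 2 rfl rfl 0 4 rfl rfl (by decide) (by decide) (by decide) rfl rfl h1 h2.symm

theorem Occurs.summable_normTerm {s : Fin 6 → ℤ} (h : Occurs s) : Summable (normTerm s) := by
  rcases h with h | ⟨i, hi, h⟩ | ⟨i, j, k, hjk, hj, hk, hi, hi', h⟩ | ⟨i, hi, h, h1, h2⟩
  · exact summable_normTerm_of_one s 0 (by have := h 0; omega) fun j _ => h j
  · exact summable_normTerm_of_one s i hi.ge h
  -- The edges `i`, `i + 3` differ from the two edges of exponent `0`, so exactly two further edges
  -- `a`, `c` remain.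
  · have key : ∀ i j k : Fin 6, j ≠ k → i ≠ j → i ≠ k → i + 3 ≠ j → i + 3 ≠ k →
        ∃ a c : Fin 6, [i, i + 3, a, c].Nodup ∧ a ≠ j ∧ a ≠ k ∧ c ≠ j ∧ c ≠ k := by decide
    have hne : ∀ x y : Fin 6, 2 ≤ s x → s y = 0 → x ≠ y := by
      rintro x y hx hy rfl; omega
    obtain ⟨a, c, hnd, haj, hak, hcj, hck⟩ := key i j k hjk (hne _ _ hi hj) (hne _ _ hi hk)
      (hne _ _ hi' hj) (hne _ _ hi' hk)
    refine summable_normTerm_of_two s (fun l => ?_) i a c hnd hi hi' (h a haj hak) (h c hcj hck)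
    by_cases h1 : l = j
    · rw [h1, hj]
    · by_cases h2 : l = k
      · rw [h2, hk]
      · have := h l h1 h2; omega
  · exact summable_normTerm_of_negOne i hi h h1 h2

end

/-! ### Bounds for the derivatives of the summand -/

section

open Metric Filter Topology

/-- The inverse propagator `π |p₁ + p₂ z|² / Im z` of a real momentum. -/
def invPropagator (p : ℝ × ℝ) (z : ℂ) : ℝ :=
  Real.pi * ((p.1 + p.2 * z.re) ^ 2 + (p.2 * z.im) ^ 2) / z.im

theorem invPropagator_pos {p : ℝ × ℝ} (hp : p ≠ 0) {z : ℂ} (hz : 0 < z.im) :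
    0 < invPropagator p z := by
  have : 0 < (p.1 + p.2 * z.re) ^ 2 + (p.2 * z.im) ^ 2 := by
    by_cases h2 : p.2 = 0
    · have h1 : p.1 ≠ 0 := fun h1 => hp (Prod.ext h1 h2)
      rw [h2]; simp; positivity
    · have : p.2 * z.im ≠ 0 := mul_ne_zero h2 hz.ne'
      positivity
  unfold invPropagator
  have := Real.pi_pos
  positivity

theorem invPropagator_smul (r : ℝ) (p : ℝ × ℝ) (z : ℂ) :
    invPropagator (r • p) z = r ^ 2 * invPropagator p z := by
  simp only [invPropagator, Prod.smul_fst, Prod.smul_snd, smul_eq_mul]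
  ring

/-- The summand of the lattice sum for real edge momenta and a complex parameter. -/
def realTerm (s : Fin 6 → ℤ) (q : Fin 6 → ℝ × ℝ) (z : ℂ) : ℝ :=
  ∏ j, invPropagator (q j) z ^ (-s j)

theorem realTerm_smul (s : Fin 6 → ℤ) (r : Fin 6 → ℝ) (q : Fin 6 → ℝ × ℝ) (z : ℂ) :
    realTerm s (fun j => r j • q j) z = (∏ j, (r j)⁻¹ ^ (2 * s j)) * realTerm s q z := by
  simp only [realTerm, invPropagator_smul, mul_zpow, Finset.prod_mul_distrib]
  congr 1
  refine Finset.prod_congr rfl fun j _ => ?_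
  rw [inv_zpow', ← zpow_natCast, ← zpow_mul]
  congr 1
  push_cast; ring

/-- The set of pairs of non-zero edge momenta and a point of the upper half plane. -/
def regularSet : Set ((Fin 6 → ℝ × ℝ) × ℂ) := {x | (∀ j, x.1 j ≠ 0) ∧ 0 < x.2.im}

theorem contDiffAt_realTerm (s : Fin 6 → ℤ) {x : (Fin 6 → ℝ × ℝ) × ℂ} (hx : x ∈ regularSet)
    (n : ℕ) : ContDiffAt ℝ n (fun x : (Fin 6 → ℝ × ℝ) × ℂ => realTerm s x.1 x.2) x := by
  unfold realTerm
  refine contDiffAt_prod fun j _ => ?_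
  have hre : ContDiff ℝ n fun x : (Fin 6 → ℝ × ℝ) × ℂ => x.2.re :=
    Complex.reCLM.contDiff.comp contDiff_snd
  have him : ContDiff ℝ n fun x : (Fin 6 → ℝ × ℝ) × ℂ => x.2.im :=
    Complex.imCLM.contDiff.comp contDiff_snd
  have hq : ContDiff ℝ n fun x : (Fin 6 → ℝ × ℝ) × ℂ => x.1 j :=
    (contDiff_apply ℝ (ℝ × ℝ) j).comp contDiff_fst
  have h : ContDiffAt ℝ n (fun x : (Fin 6 → ℝ × ℝ) × ℂ => invPropagator (x.1 j) x.2) x := by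
    unfold invPropagator
    refine ContDiffAt.div ?_ him.contDiffAt hx.2.ne'
    exact (contDiff_const.mul (((hq.fst.add (hq.snd.mul hre)).pow 2).add
      ((hq.snd.mul him).pow 2))).contDiffAt
  have h0 := (invPropagator_pos (hx.1 j) hx.2).ne'
  cases hs : -s j with
  | ofNat m => simpa using h.pow m
  | negSucc m =>
    simp only [zpow_negSucc]
    exact (h.pow (m + 1)).inv (pow_ne_zero _ h0)

/-- The lattice summand cut off by a function of `z`, as a function of all variables. -/
def cutTerm (χ : ℂ → ℝ) (s : Fin 6 → ℤ) (x : (Fin 6 → ℝ × ℝ) × ℂ) : ℝ :=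
  χ x.2 * realTerm s x.1 x.2

/-- The cutoff removes the condition on `z`: off its support the function vanishes locally. This
gives functions smooth on all of `ℂ`, as differentiation of a series under global bounds requires.
-/
theorem contDiffAt_cutTerm {χ : ℂ → ℝ} (n : ℕ) (hχ : ContDiff ℝ n χ)
    (hsupp : tsupport χ ⊆ {z | 0 < z.im}) (s : Fin 6 → ℤ) {x : (Fin 6 → ℝ × ℝ) × ℂ}
    (hx : ∀ j, x.1 j ≠ 0) : ContDiffAt ℝ n (cutTerm χ s) x := by
  by_cases h : x.2 ∈ tsupport χ
  · exact (hχ.comp contDiff_snd).contDiffAt.mul (contDiffAt_realTerm s ⟨hx, hsupp h⟩ n)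
  · have h0 : χ =ᶠ[𝓝 x.2] 0 := notMem_tsupport_iff_eventuallyEq.mp h
    have h1 : cutTerm χ s =ᶠ[𝓝 x] fun _ => 0 := by
      filter_upwards [continuousAt_snd.eventually h0] with y hy
      simp [cutTerm, hy]
    exact contDiffAt_const.congr_of_eventuallyEq h1

theorem contDiff_cutTerm {χ : ℂ → ℝ} (n : ℕ) (hχ : ContDiff ℝ n χ)
    (hsupp : tsupport χ ⊆ {z | 0 < z.im}) (s : Fin 6 → ℤ) {q : Fin 6 → ℝ × ℝ}
    (hq : ∀ j, q j ≠ 0) : ContDiff ℝ n fun z => cutTerm χ s (q, z) :=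
  contDiff_iff_contDiffAt.mpr fun z =>
    (contDiffAt_cutTerm n hχ hsupp s (x := (q, z)) hq).comp z
      (contDiff_prodMk_right q).contDiffAt

theorem isOpen_nonzero : IsOpen {x : (Fin 6 → ℝ × ℝ) × ℂ | ∀ j, x.1 j ≠ 0} := by
  simp only [Set.ofPred_forall]
  exact isOpen_iInter_of_finite fun j =>
    isOpen_ne_fun ((continuous_apply j).comp continuous_fst) continuous_const

/-- Passing to the derivative in all variables gives a bound that is jointly continuous in `q` and
`z`, which the compactness argument below needs. -/
theorem norm_iteratedFDeriv_slice_le {χ : ℂ → ℝ} (n : ℕ) (hχ : ContDiff ℝ n χ)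
    (hsupp : tsupport χ ⊆ {z | 0 < z.im}) (s : Fin 6 → ℤ) {q : Fin 6 → ℝ × ℝ}
    (hq : ∀ j, q j ≠ 0) (z : ℂ) :
    ‖iteratedFDeriv ℝ n (fun z => cutTerm χ s (q, z)) z‖ ≤
      ‖iteratedFDeriv ℝ n (cutTerm χ s) (q, z)‖ := by
  -- After translation by `(q, 0)` the slice becomes a linear inclusion of norm at most `1`, so the
  -- chain rule for linear maps applies.
  set g : ℂ →L[ℝ] (Fin 6 → ℝ × ℝ) × ℂ := ContinuousLinearMap.inr ℝ _ _
  set U : Set ((Fin 6 → ℝ × ℝ) × ℂ) := {x | ∀ j, (x + (q, 0)).1 j ≠ 0}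
  have hU : IsOpen U := isOpen_nonzero.preimage (by fun_prop : Continuous fun x => x + (q, (0 : ℂ)))
  have hF : ContDiffOn ℝ n (fun x => cutTerm χ s (x + (q, 0))) U := fun x hx =>
    ((contDiffAt_cutTerm n hχ hsupp s hx).comp x
      (contDiff_id.add contDiff_const).contDiffAt).contDiffWithinAt
  have hgz : g z ∈ U := fun j => by simpa [g] using hq j
  have hgU : IsOpen (g ⁻¹' U) := hU.preimage g.continuous
  have h := g.iteratedFDerivWithin_comp_right hF hU.uniqueDiffOn hgU.uniqueDiffOn hgz le_rfl
  rw [iteratedFDerivWithin_of_isOpen _ hgU hgz, iteratedFDerivWithin_of_isOpen _ hU hgz,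
    iteratedFDeriv_comp_add_right] at h
  have e : ((fun x => cutTerm χ s (x + (q, 0))) ∘ g) = fun z => cutTerm χ s (q, z) := by
    ext z; simp [g]
  have e2 : g z + (q, 0) = (q, z) := by simp [g]
  rw [e, e2] at h
  rw [h]
  refine (ContinuousMultilinearMap.norm_compContinuousLinearMap_le _ _).trans ?_
  refine mul_le_of_le_one_right (norm_nonneg _) (Finset.prod_le_one (fun _ _ => norm_nonneg _)
    fun _ _ => ?_)
  exact ContinuousLinearMap.norm_inr_le_one ℝ _ _

/-- Scaling each `q j` to the unit sphere extracts exactly `‖q j‖ ^ (-2 s_j)`, and what is left is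
continuous on a compact set. The six momenta are treated as independent, so conservation plays no
role here. -/
theorem exists_iteratedFDeriv_cutTerm_le {χ : ℂ → ℝ} (n : ℕ) (hχ : ContDiff ℝ n χ)
    (hc : HasCompactSupport χ) (hsupp : tsupport χ ⊆ {z | 0 < z.im}) (s : Fin 6 → ℤ) :
    ∃ C : ℝ, ∀ q : Fin 6 → ℝ × ℝ, (∀ j, q j ≠ 0) → ∀ z,
      ‖iteratedFDeriv ℝ n (fun z => cutTerm χ s (q, z)) z‖ ≤ C * ∏ j, ‖q j‖⁻¹ ^ (2 * s j) := by
  set S : Set (Fin 6 → ℝ × ℝ) := Set.univ.pi fun _ => sphere 0 1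
  have hS : IsCompact S := isCompact_univ_pi fun _ => isCompact_sphere _ _
  have hS0 : ∀ q ∈ S, ∀ j, q j ≠ 0 := fun q hq j h => by
    have := hq j trivial
    rw [h] at this
    simp at this
  have hcont : ContinuousOn (fun x => iteratedFDeriv ℝ n (cutTerm χ s) x) (S ×ˢ tsupport χ) := by
    intro x hx
    exact ((contDiffAt_cutTerm n hχ hsupp s (hS0 _ hx.1)).iteratedFDeriv_right (m := 0)
      (by simp)).continuousAt.continuousWithinAt
  obtain ⟨C, hC⟩ := (hS.prod hc.isCompact).exists_bound_of_continuousOn hcont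
  refine ⟨max C 0, fun q hq z => ?_⟩
  have hr : ∀ j, 0 < ‖q j‖ := fun j => norm_pos_iff.mpr (hq j)
  set u : Fin 6 → ℝ × ℝ := fun j => ‖q j‖⁻¹ • q j
  have hu : u ∈ S := fun j _ => by
    simp [u, norm_smul, (hr j).ne']
  have hqu : (fun j => ‖q j‖ • u j) = q := by
    ext1 j
    simp only [u]
    rw [smul_smul, mul_inv_cancel₀ (hr j).ne', one_smul]
  have e : (fun z => cutTerm χ s (q, z)) =
      fun z => (∏ j, ‖q j‖⁻¹ ^ (2 * s j)) • cutTerm χ s (u, z) := by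
    ext z
    simp only [cutTerm, smul_eq_mul]
    conv_lhs => rw [← hqu]
    rw [realTerm_smul]
    ring
  have hP : 0 < ∏ j, ‖q j‖⁻¹ ^ (2 * s j) :=
    Finset.prod_pos fun j _ => zpow_pos (inv_pos.mpr (hr j)) _
  rw [e, iteratedFDeriv_const_smul_apply' (contDiff_cutTerm n hχ hsupp s (hS0 u hu)).contDiffAt, norm_smul,
    Real.norm_of_nonneg hP.le, mul_comm]
  refine mul_le_mul_of_nonneg_right ?_ hP.le
  by_cases hz : z ∈ tsupport χ
  · exact (norm_iteratedFDeriv_slice_le n hχ hsupp s (hS0 u hu) z).trans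
      ((hC (u, z) ⟨hu, hz⟩).trans (le_max_left _ _))
  · have h0 : (fun z => cutTerm χ s (u, z)) =ᶠ[𝓝 z] 0 := by
      filter_upwards [notMem_tsupport_iff_eventuallyEq.mp hz] with y hy
      simp [cutTerm, hy]
    rw [(Filter.EventuallyEq.iteratedFDeriv ℝ h0 n).self_of_nhds]
    simp

/-- The edge momenta as real pairs. -/
def realMomentum (k : LoopMomenta) (j : Fin 6) : ℝ × ℝ :=
  ((edgeMomentum k.1 j).1, (edgeMomentum k.1 j).2)

theorem norm_realMomentum (k : LoopMomenta) (j : Fin 6) :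
    ‖realMomentum k j‖ = ‖edgeMomentum k.1 j‖ := by
  simp [realMomentum, Prod.norm_def, Int.norm_eq_abs]

theorem realMomentum_ne_zero (k : LoopMomenta) (j : Fin 6) : realMomentum k j ≠ 0 := by
  rw [← norm_pos_iff, norm_realMomentum]
  exact norm_pos_iff.mpr (k.2 j)

theorem propagator_eq (τ : ℍ) (p : ℤ × ℤ) :
    propagator τ p = (invPropagator ((p.1 : ℝ), (p.2 : ℝ)) τ)⁻¹ := by
  have h : ‖(p.1 : ℂ) + (p.2 : ℂ) * (τ : ℂ)‖ ^ 2 =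
      ((p.1 : ℝ) + p.2 * (τ : ℂ).re) ^ 2 + (p.2 * (τ : ℂ).im) ^ 2 := by
    rw [Complex.sq_norm, Complex.normSq_apply]
    simp [Complex.add_re, Complex.mul_re, Complex.add_im, Complex.mul_im]
    ring
  rw [propagator, h, invPropagator, inv_div]
  rfl

theorem latticeTerm_eq (s : Fin 6 → ℤ) (τ : ℍ) (k : LoopMomenta) :
    latticeTerm s τ k = realTerm s (realMomentum k) τ := by
  unfold latticeTerm realTerm
  refine Finset.prod_congr rfl fun j _ => ?_
  rw [propagator_eq, inv_zpow', realMomentum]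

theorem exists_cutoff (τ : ℍ) : ∃ χ : ℂ → ℝ, ContDiff ℝ 2 χ ∧ HasCompactSupport χ ∧
    tsupport χ ⊆ {z | 0 < z.im} ∧ χ =ᶠ[𝓝 (τ : ℂ)] 1 := by
  have hopen : IsOpen {z : ℂ | 0 < z.im} := isOpen_lt continuous_const Complex.continuous_im
  obtain ⟨ε, hε, hball⟩ := Metric.isOpen_iff.mp hopen (τ : ℂ) τ.im_pos
  let f : ContDiffBump (τ : ℂ) := ⟨ε / 4, ε / 2, by positivity, by linarith⟩
  refine ⟨f, f.contDiff, f.hasCompactSupport, ?_, f.eventuallyEq_one⟩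
  rw [f.tsupport_eq]
  exact (closedBall_subset_ball (by simp [f]; linarith)).trans hball

theorem exists_iteratedFDeriv_le_normTerm {χ : ℂ → ℝ} (hχ : ContDiff ℝ 2 χ)
    (hc : HasCompactSupport χ) (hsupp : tsupport χ ⊆ {z | 0 < z.im}) (s : Fin 6 → ℤ) (n : ℕ)
    (hn : n ≤ 2) : ∃ C : ℝ, ∀ (k : LoopMomenta) (z : ℂ),
      ‖iteratedFDeriv ℝ n (fun z => cutTerm χ s (realMomentum k, z)) z‖ ≤ C * normTerm s k := by
  obtain ⟨C, hC⟩ := exists_iteratedFDeriv_cutTerm_le n (hχ.of_le (by exact_mod_cast hn)) hc hsupp s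
  refine ⟨C, fun k z => ?_⟩
  simpa only [norm_realMomentum, normTerm, invNorm] using hC _ (realMomentum_ne_zero k) z

theorem Occurs.summable_latticeTerm {s : Fin 6 → ℤ} (h : Occurs s) (τ : ℍ) :
    Summable (latticeTerm s τ) := by
  obtain ⟨χ, hχ, hc, hsupp, h1⟩ := exists_cutoff τ
  obtain ⟨C, hC⟩ := exists_iteratedFDeriv_le_normTerm hχ hc hsupp s 0 (by norm_num)
  refine Summable.of_norm_bounded (h.summable_normTerm.mul_left C) fun k => ?_
  have := hC k τ
  rw [norm_iteratedFDeriv_zero, cutTerm, h1.self_of_nhds, Pi.one_apply, one_mul] at this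
  rwa [latticeTerm_eq]

theorem modularGraphFn_comp_ofComplex_eq {s : Fin 6 → ℤ} {χ : ℂ → ℝ} {τ : ℍ}
    (h1 : χ =ᶠ[𝓝 (τ : ℂ)] 1) :
    modularGraphFn s ∘ UpperHalfPlane.ofComplex =ᶠ[𝓝 (τ : ℂ)]
      fun z => ∑' k, cutTerm χ s (realMomentum k, z) := by
  have hopen : IsOpen {z : ℂ | 0 < z.im} := isOpen_lt continuous_const Complex.continuous_im
  filter_upwards [h1, hopen.mem_nhds τ.im_pos] with z hz him
  rw [Function.comp_apply, UpperHalfPlane.ofComplex_apply_of_im_pos him]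
  refine tsum_congr fun k => ?_
  simp only [latticeTerm_eq, cutTerm, hz, Pi.one_apply, one_mul]

theorem exists_bounds {χ : ℂ → ℝ} (hχ : ContDiff ℝ 2 χ) (hc : HasCompactSupport χ)
    (hsupp : tsupport χ ⊆ {z | 0 < z.im}) {s : Fin 6 → ℤ} (h : Occurs s) :
    ∃ v : ℕ → LoopMomenta → ℝ, (∀ n : ℕ, (n : ℕ∞) ≤ 2 → Summable (v n)) ∧
      ∀ (n : ℕ) (k : LoopMomenta) (z : ℂ), (n : ℕ∞) ≤ 2 →
        ‖iteratedFDeriv ℝ n (fun z => cutTerm χ s (realMomentum k, z)) z‖ ≤ v n k := by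
  have H : ∀ n : ℕ, ∃ C : ℝ, n ≤ 2 → ∀ (k : LoopMomenta) (z : ℂ),
      ‖iteratedFDeriv ℝ n (fun z => cutTerm χ s (realMomentum k, z)) z‖ ≤ C * normTerm s k := by
    intro n
    by_cases hn : n ≤ 2
    · obtain ⟨C, hC⟩ := exists_iteratedFDeriv_le_normTerm hχ hc hsupp s n hn
      exact ⟨C, fun _ => hC⟩
    · exact ⟨0, fun h => absurd h hn⟩
  choose C hC using H
  exact ⟨fun n k => C n * normTerm s k, fun n _ => h.summable_normTerm.mul_left _,
    fun n k z hn => hC n (by exact_mod_cast hn) k z⟩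

theorem Occurs.contDiffAt_modularGraphFn {s : Fin 6 → ℤ} (h : Occurs s) (τ : ℍ) :
    ContDiffAt ℝ 2 (modularGraphFn s ∘ UpperHalfPlane.ofComplex) (τ : ℂ) := by
  obtain ⟨χ, hχ, hc, hsupp, h1⟩ := exists_cutoff τ
  obtain ⟨v, hv, hb⟩ := exists_bounds hχ hc hsupp h
  refine ContDiffAt.congr_of_eventuallyEq ?_ (modularGraphFn_comp_ofComplex_eq h1)
  exact (contDiff_tsum (N := 2) (fun k => contDiff_cutTerm 2 hχ hsupp s (realMomentum_ne_zero k))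
    hv hb).contDiffAt

/-- The series of second derivatives converges in norm, hence also after evaluation on the pairs
`(1, 1)` and `(i, i)`, whose sum is the Laplacian. -/
theorem Occurs.hasSum_hypLaplacian {s : Fin 6 → ℤ} (h : Occurs s) (τ : ℍ) :
    HasSum (fun k => τ.im ^ 2 * Laplacian.laplacian (realTerm s (realMomentum k)) (τ : ℂ))
      (hypLaplacian (modularGraphFn s) τ) := by
  obtain ⟨χ, hχ, hc, hsupp, h1⟩ := exists_cutoff τ
  obtain ⟨v, hv, hb⟩ := exists_bounds hχ hc hsupp h
  refine HasSum.mul_left _ ?_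
  have hsum := (Summable.of_norm_bounded (hv 2 le_rfl) fun k => hb 2 k (τ : ℂ) le_rfl).hasSum
  rw [← iteratedFDeriv_tsum_apply (N := 2)
    (fun k => contDiff_cutTerm 2 hχ hsupp s (realMomentum_ne_zero k)) hv hb le_rfl,
    ← (Filter.EventuallyEq.iteratedFDeriv ℝ (modularGraphFn_comp_ofComplex_eq h1) 2).self_of_nhds] at hsum
  have happ := fun m : Fin 2 → ℂ =>
    hsum.mapL (ContinuousMultilinearMap.apply ℝ (fun _ : Fin 2 => ℂ) ℝ m)
  have := (happ ![1, 1]).add (happ ![Complex.I, Complex.I])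
  rw [InnerProductSpace.laplacian_eq_iteratedFDeriv_complexPlane]
  refine this.congr_fun fun k => ?_
  rw [InnerProductSpace.laplacian_eq_iteratedFDeriv_complexPlane]
  have e : realTerm s (realMomentum k) =ᶠ[𝓝 (τ : ℂ)] fun z => cutTerm χ s (realMomentum k, z) := by
    filter_upwards [h1] with z hz
    simp [cutTerm, hz]
  beta_reduce
  rw [(Filter.EventuallyEq.iteratedFDeriv ℝ e 2).self_of_nhds]
  rfl

end

/-! ### The Laplacian of the summand -/

section

open Filter Topology

/-- The second derivative of a `C²` function along a line, computed from a derivative along it. -/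
theorem iteratedFDeriv_two_eq_of_hasDerivAt {f : ℂ → ℝ} {z v : ℂ} (hf : ContDiffAt ℝ 2 f z)
    {g : ℝ → ℝ} {c : ℝ} (h1 : ∀ᶠ r : ℝ in 𝓝 0, HasDerivAt (fun r : ℝ => f (z + r • v)) (g r) r)
    (h2 : HasDerivAt g c 0) : iteratedFDeriv ℝ 2 f z ![v, v] = c := by
  have hline : ∀ r : ℝ, HasDerivAt (fun r : ℝ => z + r • v) v r := fun r => by
    simpa using ((hasDerivAt_id r).smul_const v).const_add z
  have hz : Tendsto (fun r : ℝ => z + r • v) (𝓝 0) (𝓝 z) := by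
    have := (hline 0).continuousAt.tendsto
    simpa using this
  have hdiff : ∀ᶠ r : ℝ in 𝓝 0, DifferentiableAt ℝ f (z + r • v) := by
    refine hz.eventually ?_
    filter_upwards [hf.eventually (by simp)] with w hw
    exact hw.differentiableAt (by simp)
  -- Uniqueness of derivatives identifies `g` with the directional derivative near `0`, so `c` is a
  -- second derivative of `f`.
  have hg : g =ᶠ[𝓝 0] fun r => fderiv ℝ f (z + r • v) v := by
    filter_upwards [h1, hdiff] with r hr hd
    exact hr.unique (hd.hasFDerivAt.comp_hasDerivAt r (hline r))
  have hf' : HasFDerivAt (fderiv ℝ f) (fderiv ℝ (fderiv ℝ f) z) (z + (0 : ℝ) • v) := by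
    simpa using ((hf.fderiv_right (m := 1) (by norm_num)).differentiableAt (by simp)).hasFDerivAt
  have h3 : HasFDerivAt (fun w => fderiv ℝ f w v) ((fderiv ℝ (fderiv ℝ f) z).flip v)
      (z + (0 : ℝ) • v) := by
    simpa using hf'.clm_apply (hasFDerivAt_const v _)
  have h4 : HasDerivAt (fun r : ℝ => fderiv ℝ f (z + r • v) v) ((fderiv ℝ (fderiv ℝ f) z).flip v v)
      0 := HasFDerivAt.comp_hasDerivAt (f := fun r : ℝ => z + r • v)
        (l := fun w => fderiv ℝ f w v) (0 : ℝ) h3 (hline 0)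
  rw [iteratedFDeriv_two_apply]
  exact h4.unique (h2.congr_of_eventuallyEq hg.symm)

/-- The logarithmic formula for the second derivative of a product of integral powers. -/
theorem hasDerivAt_prod_zpow (s : Fin 6 → ℤ) {x x' : Fin 6 → ℝ → ℝ} {r : ℝ}
    (hx : ∀ j, HasDerivAt (x j) (x' j r) r) (hpos : ∀ j, 0 < x j r) :
    HasDerivAt (fun r => ∏ j, x j r ^ (-s j))
      ((∏ j, x j r ^ (-s j)) * ∑ j, -(s j : ℝ) * (x' j r / x j r)) r := by
  have h := HasDerivAt.fun_finsetProd (u := Finset.univ) fun j _ =>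
    (hasDerivAt_zpow (-s j) (x j r) (Or.inl (hpos j).ne')).comp r (hx j)
  refine h.congr_deriv ?_
  rw [Finset.mul_sum]
  refine Finset.sum_congr rfl fun j _ => Eq.symm ?_
  rw [← Finset.mul_prod_erase Finset.univ _ (Finset.mem_univ j), smul_eq_mul,
    zpow_sub_one₀ (hpos j).ne']
  simp only [Function.comp_apply]
  push_cast
  field_simp

theorem hasDerivAt_prod_zpow_deriv (s : Fin 6 → ℤ) {x x' : Fin 6 → ℝ → ℝ} {x'' : Fin 6 → ℝ} {r : ℝ}
    (hx : ∀ j, HasDerivAt (x j) (x' j r) r) (hx' : ∀ j, HasDerivAt (x' j) (x'' j) r)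
    (hpos : ∀ j, 0 < x j r) :
    HasDerivAt (fun r => (∏ j, x j r ^ (-s j)) * ∑ j, -(s j : ℝ) * (x' j r / x j r))
      ((∏ j, x j r ^ (-s j)) * ((∑ j, (s j : ℝ) * (x' j r / x j r)) ^ 2 -
        ∑ j, (s j : ℝ) * (x'' j / x j r - (x' j r / x j r) ^ 2))) r := by
  have h2 : HasDerivAt (fun r => ∑ j, -(s j : ℝ) * (x' j r / x j r))
      (∑ j, -(s j : ℝ) * ((x'' j * x j r - x' j r * x' j r) / x j r ^ 2)) r :=
    HasDerivAt.fun_sum fun j _ => ((hx' j).div (hx j) (hpos j).ne').const_mul _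
  refine ((hasDerivAt_prod_zpow s hx hpos).mul h2).congr_deriv ?_
  have e : ∀ j, (x'' j * x j r - x' j r * x' j r) / x j r ^ 2 =
      x'' j / x j r - (x' j r / x j r) ^ 2 := fun j => by
    have := (hpos j).ne'
    field_simp
  simp only [e, neg_mul, Finset.sum_neg_distrib]
  ring

/-- The Hermitian pairing of two momenta whose diagonal is `invPropagator`. -/
def pairing (p q : ℝ × ℝ) (z : ℂ) : ℝ :=
  Real.pi * ((p.1 + p.2 * z.re) * (q.1 + q.2 * z.re) + p.2 * q.2 * z.im ^ 2) / z.im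

/-- `(Im z)²` times the scalar product of the gradients of two inverse propagators. -/
def gradPairing (p q : ℝ × ℝ) (z : ℂ) : ℝ :=
  2 * pairing p q z ^ 2 - invPropagator p z * invPropagator q z

/-- Logarithmic differentiation along the real and the imaginary direction: the squared first-order
sums give the double sum of gradient products, and `τ₂² Δ log X = 2 - 1 = 1` gives the subtracted `∑
s_j`. -/
theorem laplacian_realTerm (s : Fin 6 → ℤ) {q : Fin 6 → ℝ × ℝ} (hq : ∀ j, q j ≠ 0) {z : ℂ}
    (hz : 0 < z.im) :
    z.im ^ 2 * Laplacian.laplacian (realTerm s q) z =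
      realTerm s q z * (∑ i, ∑ j, s i * s j * (gradPairing (q i) (q j) z /
        (invPropagator (q i) z * invPropagator (q j) z)) - ∑ j, (s j : ℝ)) := by
  have hcd : ContDiffAt ℝ 2 (realTerm s q) z :=
    (contDiffAt_realTerm s (x := (q, z)) ⟨hq, hz⟩ 2).comp z (contDiff_prodMk_right q).contDiffAt
  set x1 : Fin 6 → ℝ → ℝ := fun j r =>
    Real.pi * (((q j).1 + (q j).2 * (z.re + r)) ^ 2 + ((q j).2 * z.im) ^ 2) / z.im with hx1
  set x1' : Fin 6 → ℝ → ℝ := fun j r =>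
    2 * Real.pi * (q j).2 * ((q j).1 + (q j).2 * (z.re + r)) / z.im with hx1'
  set x2 : Fin 6 → ℝ → ℝ := fun j r =>
    Real.pi * (((q j).1 + (q j).2 * z.re) ^ 2 + ((q j).2 * (z.im + r)) ^ 2) / (z.im + r) with hx2
  set x2' : Fin 6 → ℝ → ℝ := fun j r =>
    Real.pi * ((q j).2 ^ 2 - ((q j).1 + (q j).2 * z.re) ^ 2 / (z.im + r) ^ 2) with hx2'
  have e1 : ∀ r : ℝ, realTerm s q (z + r • (1 : ℂ)) = ∏ j, x1 j r ^ (-s j) := fun r => by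
    simp [realTerm, invPropagator, hx1]
  have e2 : ∀ r : ℝ, realTerm s q (z + r • Complex.I) = ∏ j, x2 j r ^ (-s j) := fun r => by
    simp [realTerm, invPropagator, hx2]
  have p1 : ∀ r j, 0 < x1 j r := fun r j => by
    have := invPropagator_pos (hq j) (z := z + r) (by simpa using hz)
    simpa [invPropagator] using this
  have p2 : ∀ r : ℝ, 0 < z.im + r → ∀ j, 0 < x2 j r := fun r hr j => by
    have := invPropagator_pos (hq j) (z := z + r * Complex.I) (by simpa using hr)
    simpa [invPropagator] using this
  have d1 : ∀ r j, HasDerivAt (x1 j) (x1' j r) r := fun r j => by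
    have := (((((((hasDerivAt_id r).const_add z.re).const_mul (q j).2).const_add (q j).1).pow
      2).add_const (((q j).2 * z.im) ^ 2)).const_mul Real.pi).div_const z.im
    refine this.congr_deriv ?_
    simp [hx1']; ring
  have d1' : ∀ r j, HasDerivAt (x1' j) (2 * Real.pi * (q j).2 ^ 2 / z.im) r := fun r j => by
    have := ((((((hasDerivAt_id r).const_add z.re).const_mul (q j).2).const_add (q j).1)).const_mul
      (2 * Real.pi * (q j).2)).div_const z.im
    refine this.congr_deriv ?_
    ring
  have d2 : ∀ r : ℝ, 0 < z.im + r → ∀ j, HasDerivAt (x2 j) (x2' j r) r := fun r hr j => by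
    have h0 := (hasDerivAt_id r).const_add z.im
    have := (((((h0.const_mul (q j).2).pow 2).const_add (((q j).1 + (q j).2 * z.re) ^ 2)).const_mul
      Real.pi).div h0 hr.ne')
    refine this.congr_deriv ?_
    have := hr.ne'
    simp [hx2']; field_simp; ring
  have d2' : ∀ r : ℝ, 0 < z.im + r → ∀ j, HasDerivAt (x2' j)
      (2 * Real.pi * ((q j).1 + (q j).2 * z.re) ^ 2 / (z.im + r) ^ 3) r := fun r hr j => by
    have h0 := (hasDerivAt_id r).const_add z.im
    have := ((((hasDerivAt_const r (((q j).1 + (q j).2 * z.re) ^ 2)).div (h0.pow 2)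
      (pow_ne_zero 2 hr.ne'))).const_sub ((q j).2 ^ 2)).const_mul Real.pi
    refine this.congr_deriv ?_
    have := hr.ne'
    simp; field_simp
  have hz0 : 0 < z.im + 0 := by simpa using hz
  -- The vertical line stays in the upper half plane only for small `r`, so the derivative formula
  -- there is local.
  have hev : ∀ᶠ r : ℝ in 𝓝 0, 0 < z.im + r :=
    (continuous_const.add continuous_id).continuousAt.eventually (lt_mem_nhds hz0)
  have l1 := iteratedFDeriv_two_eq_of_hasDerivAt (v := 1) hcd
    (Eventually.of_forall fun r => by
      simp only [e1]; exact hasDerivAt_prod_zpow s (d1 r) (p1 r))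
    (hasDerivAt_prod_zpow_deriv s (d1 0) (d1' 0) (p1 0))
  have l2 := iteratedFDeriv_two_eq_of_hasDerivAt (v := Complex.I) hcd
    (hev.mono fun r hr => by
      simp only [e2]; exact hasDerivAt_prod_zpow s (d2 r hr) (p2 r hr))
    (hasDerivAt_prod_zpow_deriv s (d2 0 hz0) (d2' 0 hz0) (p2 0 hz0))
  have f1 : ∀ j, x1 j 0 = invPropagator (q j) z := fun j => by simp [hx1, invPropagator]
  have f2 : ∀ j, x2 j 0 = invPropagator (q j) z := fun j => by simp [hx2, invPropagator]
  simp only [f1] at l1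
  simp only [f2, add_zero] at l2
  rw [InnerProductSpace.laplacian_eq_iteratedFDeriv_complexPlane]
  simp only [l1, l2]
  change _ = (∏ j, invPropagator (q j) z ^ (-s j)) * _
  rw [← mul_add, mul_left_comm]
  congr 1
  have hp := fun j => (invPropagator_pos (hq j) hz).ne'
  have g1 : ∀ i j, gradPairing (q i) (q j) z =
      z.im ^ 2 * (x1' i 0 * x1' j 0 + x2' i 0 * x2' j 0) := fun i j => by
    simp only [gradPairing, pairing, invPropagator, hx1', hx2', add_zero]
    field_simp
    ring
  -- Each inverse propagator is an eigenfunction of the hyperbolic Laplacian with eigenvalue `2`.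
  have g2 : ∀ j, z.im ^ 2 * (2 * Real.pi * (q j).2 ^ 2 / z.im +
      2 * Real.pi * ((q j).1 + (q j).2 * z.re) ^ 2 / z.im ^ 3) = 2 * invPropagator (q j) z :=
    fun j => by
      simp only [invPropagator]
      field_simp
      ring
  have g3 : ∀ j, gradPairing (q j) (q j) z = invPropagator (q j) z ^ 2 := fun j => by
    simp only [gradPairing, pairing, invPropagator]
    ring
  have t1 : ∑ i, ∑ j, s i * s j * (gradPairing (q i) (q j) z /
        (invPropagator (q i) z * invPropagator (q j) z)) =
      z.im ^ 2 * ((∑ j, (s j : ℝ) * (x1' j 0 / invPropagator (q j) z)) ^ 2 +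
        (∑ j, (s j : ℝ) * (x2' j 0 / invPropagator (q j) z)) ^ 2) := by
    rw [sq (∑ j, _), sq (∑ j, _), Finset.sum_mul_sum, Finset.sum_mul_sum,
      ← Finset.sum_add_distrib, Finset.mul_sum]
    refine Finset.sum_congr rfl fun i _ => ?_
    rw [← Finset.sum_add_distrib, Finset.mul_sum]
    refine Finset.sum_congr rfl fun j _ => ?_
    rw [g1]
    have := hp i
    have := hp j
    field_simp
  have t2 : ∑ j, (s j : ℝ) = z.im ^ 2 * (∑ j, (s j : ℝ) *
      (2 * Real.pi * (q j).2 ^ 2 / z.im / invPropagator (q j) z -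
        (x1' j 0 / invPropagator (q j) z) ^ 2) + ∑ j, (s j : ℝ) *
      (2 * Real.pi * ((q j).1 + (q j).2 * z.re) ^ 2 / z.im ^ 3 / invPropagator (q j) z -
        (x2' j 0 / invPropagator (q j) z) ^ 2)) := by
    rw [← Finset.sum_add_distrib, Finset.mul_sum]
    refine Finset.sum_congr rfl fun j _ => ?_
    have := hp j
    have a1 := g2 j
    have a2 := (g1 j j).symm.trans (g3 j)
    generalize invPropagator (q j) z = X at *
    generalize x1' j 0 = A at *
    generalize x2' j 0 = B at *
    generalize 2 * Real.pi * (q j).2 ^ 2 / z.im = D at *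
    generalize 2 * Real.pi * ((q j).1 + (q j).2 * z.re) ^ 2 / z.im ^ 3 = E at *
    field_simp
    linear_combination (-X * s j) * a1 + s j * a2
  rw [t1, t2]
  ring

end

/-! ### Generating functions of arbitrary coefficients -/

section

open MvPowerSeries

/-- Functions of the exponents and of `τ`. -/
abbrev Coeffs : Type := (Fin 6 → ℤ) → ℍ → ℝ

/-- Lowering of the exponent of the edge `i`, i.e. multiplication of the lattice summand by the
inverse propagator of this edge. -/
def lower (i : Fin 6) : Module.End ℝ Coeffs where
  toFun a := fun s => a (s - Pi.single i 1)
  map_add' _ _ := rfl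
  map_smul' _ _ := rfl

open Classical in
/-- The generating function of arbitrary coefficients, with edges fixed as in `genFn`. -/
def gen (e : Fin 6 → Option ℤ) : Coeffs →ₗ[ℝ] Series where
  toFun a := fun n τ => if ∀ j, e j ≠ none → n j = 0 then a (fun j => (e j).getD (n j + 1)) τ else 0
  map_add' a b := by
    have key : ∀ (P : Prop) [Decidable P] (x y : ℝ),
        (if P then x + y else 0) = (if P then x else 0) + if P then y else 0 := by
      intros; split_ifs <;> simp
    funext n τ
    exact key _ _ _
  map_smul' r a := by
    have key : ∀ (P : Prop) [Decidable P] (x : ℝ),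
        (if P then r * x else 0) = r * if P then x else 0 := by
      intros; split_ifs <;> simp
    funext n τ
    exact key _ _

open Classical in
theorem coeff_gen (e : Fin 6 → Option ℤ) (a : Coeffs) (n : Fin 6 →₀ ℕ) (τ : ℍ) :
    coeff n (gen e a) τ =
      if ∀ j, e j ≠ none → n j = 0 then a (fun j => (e j).getD (n j + 1)) τ else 0 := rfl

theorem genFn_eq_gen (e : Fin 6 → Option ℤ) : genFn e = gen e modularGraphFn := by
  ext n τ
  rfl

theorem gen_lower_of_some {e : Fin 6 → Option ℤ} {i : Fin 6} {c : ℤ} (h : e i = some c)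
    (a : Coeffs) : gen e (lower i a) = gen (Function.update e i (some (c - 1))) a := by
  classical
  ext n τ
  rw [coeff_gen, coeff_gen]
  have h1 : (∀ j, e j ≠ none → n j = 0) ↔
      ∀ j, Function.update e i (some (c - 1)) j ≠ none → n j = 0 := by
    refine forall_congr' fun j => ?_
    by_cases hj : j = i
    · subst hj; simp [h]
    · simp [hj]
  simp only [h1]
  congr 1
  change a _ τ = _
  congr 1
  ext j
  by_cases hj : j = i
  · subst hj; simp [h]
  · simp [hj]

/-- Lowering an index of summation shifts the series by `t_i`, except that `s_i = 1` becomes the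
boundary value `0`. Every term of the remainder originates here or in a further lowering of such a
boundary term. -/
theorem gen_lower_of_none {e : Fin 6 → Option ℤ} {i : Fin 6} (h : e i = none) (a : Coeffs) :
    gen e (lower i a) = X i * gen e a + gen (Function.update e i (some 0)) a := by
  classical
  ext n τ
  rw [map_add, Pi.add_apply, coeff_gen, coeff_gen, X, coeff_monomial_mul, one_mul]
  by_cases hn : n i = 0
  · have h0 : ¬ Finsupp.single i 1 ≤ n := by
      rw [Finsupp.single_le_iff]; omega
    have h1 : (∀ j, e j ≠ none → n j = 0) ↔
        ∀ j, Function.update e i (some 0) j ≠ none → n j = 0 := by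
      refine forall_congr' fun j => ?_
      by_cases hj : j = i
      · subst hj; simp [hn]
      · simp [hj]
    rw [if_neg h0, Pi.zero_apply, zero_add]
    simp only [h1]
    congr 1
    change a _ τ = _
    congr 1
    ext j
    by_cases hj : j = i
    · subst hj; simp [h, hn]
    · simp [hj]
  · have h0 : Finsupp.single i 1 ≤ n := by
      rw [Finsupp.single_le_iff]; omega
    have h1 : ¬ ∀ j, Function.update e i (some 0) j ≠ none → n j = 0 := fun H =>
      hn (H i (by simp))
    have h2 : (∀ j, e j ≠ none → n j = 0) ↔
        ∀ j, e j ≠ none → (n - Finsupp.single i 1 : Fin 6 →₀ ℕ) j = 0 := by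
      refine forall_congr' fun j => ?_
      by_cases hj : j = i
      · subst hj; simp [h]
      · simp [Ne.symm hj]
    rw [if_pos h0, if_neg h1, add_zero, coeff_gen]
    simp only [h2]
    congr 1
    change a _ τ = _
    congr 1
    ext j
    by_cases hj : j = i
    · subst hj
      simp [h]
      omega
    · simp [hj]

theorem pd_apply (i : Fin 6) (f : Series) : pd i f = pderiv (ℍ → ℝ) i f := rfl

theorem t_apply (i : Fin 6) (f : Series) : t i f = X i * f := rfl

theorem coeff_pd (i : Fin 6) (f : Series) (n : Fin 6 →₀ ℕ) (τ : ℍ) :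
    coeff n (pd i f) τ = coeff (n + Finsupp.single i 1) f τ * (n i + 1) := by
  rw [pd_apply, coeff_pderiv]
  rfl

theorem pd_comm (i j : Fin 6) (f : Series) : pd i (pd j f) = pd j (pd i f) := by
  ext n τ
  simp only [coeff_pd, Finsupp.add_apply]
  rw [add_right_comm n]
  by_cases h : i = j
  · rw [h]
  · rw [Finsupp.single_eq_of_ne (Ne.symm h), Finsupp.single_eq_of_ne h]
    push_cast; ring

theorem pd_gen_of_some {e : Fin 6 → Option ℤ} {i : Fin 6} {c : ℤ} (h : e i = some c)
    (a : Coeffs) : pd i (gen e a) = 0 := by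
  classical
  ext n τ
  rw [coeff_pd, coeff_gen, if_neg, zero_mul]
  · rfl
  · intro H
    have := H i (by simp [h])
    simp at this

theorem pd_mul (i : Fin 6) (f g : Series) : pd i (f * g) = f * pd i g + g * pd i f := by
  simp only [pd_apply, Derivation.leibniz, smul_eq_mul]

theorem pd_X_self (i : Fin 6) : pd i (X i : Series) = 1 := pderiv_X_self

theorem pd_X_of_ne {i j : Fin 6} (h : j ≠ i) : pd i (X j : Series) = 0 := pderiv_X_of_ne h

end

/-! ### The Laplace operator on generating functions -/

section

open MvPowerSeries

/-- The generating function with no edge fixed, for arbitrary coefficients. -/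
abbrev genFree : Coeffs →ₗ[ℝ] Series := gen fun _ => none

/-- The generating function with one edge fixed, for arbitrary coefficients. -/
abbrev genFix (i : Fin 6) (c : ℤ) : Coeffs →ₗ[ℝ] Series :=
  gen (Function.update (fun _ => none) i (some c))

/-- The generating function with two edges set to `0`, for arbitrary coefficients. -/
abbrev genFixTwo (i j : Fin 6) : Coeffs →ₗ[ℝ] Series :=
  gen (Function.update (Function.update (fun _ => none) i (some 0)) j (some 0))

theorem genFree_lower (i : Fin 6) (a : Coeffs) :
    genFree (lower i a) = X i * genFree a + genFix i 0 a :=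
  gen_lower_of_none rfl a

theorem genFix_lower_self (i : Fin 6) (a : Coeffs) :
    genFix i 0 (lower i a) = genFix i (-1) a := by
  rw [genFix, gen_lower_of_some (c := 0) (by simp), Function.update_idem]
  rfl

theorem genFix_lower_of_ne {i j : Fin 6} (h : j ≠ i) (a : Coeffs) :
    genFix i 0 (lower j a) = X j * genFix i 0 a + genFixTwo i j a :=
  gen_lower_of_none (by simp [h]) a

theorem pd_genFix (i : Fin 6) (c : ℤ) (a : Coeffs) : pd i (genFix i c a) = 0 :=
  pd_gen_of_some (c := c) (by simp) a

theorem pd_genFixTwo_right (i j : Fin 6) (a : Coeffs) : pd j (genFixTwo i j a) = 0 :=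
  pd_gen_of_some (c := 0) (by simp) a

/-- Multiplication by twice the scalar product of the gradients of two inverse propagators `i`, `j`
that meet `k` at a vertex. -/
def adjacentShift (i j k : Fin 6) : Module.End ℝ Coeffs :=
  lower i * lower i + lower j * lower j + lower k * lower k - 2 • (lower k * lower i)
    - 2 • (lower k * lower j)

/-- Multiplication by twice the scalar product of the gradients of two opposite inverse propagators
`i`, `o`; the other edges are `a`, `b`, `c`, `d` with `a`, `c` and `b`, `d` opposite. -/
def oppositeShift (i o a b c d : Fin 6) : Module.End ℝ Coeffs :=
  lower a * lower a + lower b * lower b + lower c * lower c + lower d * lower d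
    + 2 • (lower a * lower c) + 2 • (lower b * lower d) - 2 • (lower a * lower b)
    - 2 • (lower a * lower d) - 2 • (lower b * lower c) - 2 • (lower c * lower d)
    - 2 • (lower i * lower o)

/-- No series with two edges at `0` survives: each one produced has `i` or `j` fixed and is killed
by `∂_i ∂_j`. -/
theorem pd_pd_adjacentShift {i j k : Fin 6} (hij : i ≠ j) (hik : i ≠ k) (hjk : j ≠ k)
    (a : Coeffs) :
    pd i (pd j (genFree (adjacentShift i j k a))) =
      (X i ^ 2 + X j ^ 2 + X k ^ 2 - 2 * X k * X i - 2 * X j * X k) * pd i (pd j (genFree a))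
        + 2 * X i * pd j (genFree a) + 2 * X j * pd i (genFree a)
        - 2 * X k * (pd i (genFree a) + pd j (genFree a))
        + pd j (genFix i 0 a) + pd i (genFix j 0 a)
        - (2 * pd i (genFix k 0 a) + 2 * pd j (genFix k 0 a)
          + (2 * X i + 2 * X j - X k) * pd i (pd j (genFix k 0 a)))
        + pd i (pd j (genFix k (-1) a)) := by
  simp only [adjacentShift, LinearMap.add_apply, LinearMap.sub_apply, LinearMap.smul_apply,
    Module.End.mul_apply, map_add, map_sub, map_nsmul, genFree_lower, genFix_lower_self,
    genFix_lower_of_ne hik, genFix_lower_of_ne hjk, pd_mul, pd_X_self, pd_X_of_ne hij.symm,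
    pd_X_of_ne hij, pd_X_of_ne hik.symm, pd_X_of_ne hjk.symm, pd_genFix, pd_comm i j (genFix i _ a),
    pd_genFixTwo_right, pd_comm i j (genFixTwo k i a), map_zero, mul_zero, mul_one, add_zero]
  ring

/-- The product `lower i * lower o` leaves no boundary terms after `∂_i ∂_o`, only first-order and
zeroth-order ones. The series with two edges at `0` come from the mixed products of `a`, `b`, `c`,
`d`. -/
theorem pd_pd_oppositeShift {i o a b c d : Fin 6} (hnd : [i, o, a, b, c, d].Nodup) (x : Coeffs) :
    pd i (pd o (genFree (oppositeShift i o a b c d x))) =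
      ((X a - X b + X c - X d) ^ 2 - 2 * X i * X o) * pd i (pd o (genFree x))
        - 2 * X i * pd i (genFree x) - 2 * X o * pd o (genFree x) - 2 * genFree x
        + (X a + 2 * X c - 2 * X b - 2 * X d) * pd i (pd o (genFix a 0 x))
        + (X b + 2 * X d - 2 * X a - 2 * X c) * pd i (pd o (genFix b 0 x))
        + (X c + 2 * X a - 2 * X b - 2 * X d) * pd i (pd o (genFix c 0 x))
        + (X d + 2 * X b - 2 * X a - 2 * X c) * pd i (pd o (genFix d 0 x))
        + pd i (pd o (genFix a (-1) x)) + pd i (pd o (genFix b (-1) x))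
        + pd i (pd o (genFix c (-1) x)) + pd i (pd o (genFix d (-1) x))
        + 2 * pd i (pd o (genFixTwo a c x)) + 2 * pd i (pd o (genFixTwo b d x))
        - 2 * pd i (pd o (genFixTwo a b x)) - 2 * pd i (pd o (genFixTwo a d x))
        - 2 * pd i (pd o (genFixTwo b c x)) - 2 * pd i (pd o (genFixTwo c d x)) := by
  simp only [List.nodup_cons, List.mem_cons, not_or, List.not_mem_nil, not_false_eq_true,
    List.nodup_nil, and_true] at hnd
  obtain ⟨⟨hio, hia, hib, hic, hid⟩, ⟨hoa, hob, hoc, hod⟩, ⟨hab, hac, had⟩, ⟨hbc, hbd⟩, hcd⟩ := hnd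
  simp only [oppositeShift, LinearMap.add_apply, LinearMap.sub_apply, LinearMap.smul_apply,
    Module.End.mul_apply, map_add, map_sub, map_nsmul, genFree_lower, genFix_lower_self,
    genFix_lower_of_ne (Ne.symm hab), genFix_lower_of_ne (Ne.symm hac), genFix_lower_of_ne (Ne.symm had),
    genFix_lower_of_ne (Ne.symm hbc), genFix_lower_of_ne (Ne.symm hbd), genFix_lower_of_ne (Ne.symm hcd),
    genFix_lower_of_ne (Ne.symm hio), pd_mul, pd_X_self,
    pd_X_of_ne hio, pd_X_of_ne (Ne.symm hio), pd_X_of_ne (Ne.symm hia), pd_X_of_ne (Ne.symm hib),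
    pd_X_of_ne (Ne.symm hic), pd_X_of_ne (Ne.symm hid), pd_X_of_ne (Ne.symm hoa), pd_X_of_ne (Ne.symm hob),
    pd_X_of_ne (Ne.symm hoc), pd_X_of_ne (Ne.symm hod), pd_genFix, pd_comm i o (genFix i 0 x), pd_genFixTwo_right, map_zero, mul_zero,
    mul_one, add_zero]
  ring

/-- The contribution `s_i² - s_i`: the first term on the left has coefficients `s_i (s_i + 1)`, and
`2 s_i` is subtracted. -/
theorem pd_diagonal (i : Fin 6) (a : Coeffs) :
    pd i (pd i (genFree ((lower i * lower i) a))) - 2 * pd i (genFree (lower i a)) =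
      X i ^ 2 * pd i (pd i (genFree a)) + 2 * X i * pd i (genFree a) := by
  simp only [Module.End.mul_apply, map_add, genFree_lower, genFix_lower_self, pd_mul, pd_X_self,
    pd_genFix, mul_one, add_zero]
  ring

theorem op_two (f : Series) : (2 : Op) f = 2 * f := by
  rw [two_mul, ← two_smul ℕ]; rfl

theorem op_four (f : Series) : (4 : Op) f = 4 * f := by
  rw [show (4 : Op) = 2 * 2 by norm_num, Module.End.mul_apply, op_two, op_two]; ring

theorem op_six (f : Series) : (6 : Op) f = 6 * f := by
  rw [show (6 : Op) = 2 + 4 by norm_num, LinearMap.add_apply, op_two, op_four]; ring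

theorem sum_fin_zero_one_two (f : Fin 6 → Series) :
    ∑ i ∈ ({0, 1, 2} : Finset (Fin 6)), f i = f 0 + f 1 + f 2 := by
  rw [Finset.sum_insert (by decide), Finset.sum_insert (by decide), Finset.sum_singleton, add_assoc]

/-- The action of the Laplacian in `τ` on generating functions of lattice summands. -/
def lapSeries (a : Coeffs) : Series :=
  ∑ i, (pd i (pd i (genFree ((lower i * lower i) a))) - 2 * pd i (genFree (lower i a)))
    + ∑ v, ∑ b : Fin 3, pd (vertexEdges v b) (pd (vertexEdges v (b + 1)) (genFree
        (adjacentShift (vertexEdges v b) (vertexEdges v (b + 1)) (vertexEdges v (b + 2)) a)))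
    + ∑ i ∈ ({0, 1, 2} : Finset (Fin 6)), pd i (pd (i + 3) (genFree
        (oppositeShift i (i + 3) (i + 1) (i + 2) (i + 4) (i + 5) a)))

theorem t_sq_apply (i : Fin 6) (f : Series) : (t i ^ 2 : Op) f = X i * (X i * f) := by
  rw [sq, Module.End.mul_apply, t_apply, t_apply]

theorem W_eq : W = genFree modularGraphFn := genFn_eq_gen _

theorem W₁_eq (i : Fin 6) (c : ℤ) : W₁ i c = genFix i c modularGraphFn := genFn_eq_gen _

theorem W₀₀_eq (i j : Fin 6) : W₀₀ i j = genFixTwo i j modularGraphFn := genFn_eq_gen _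

/-- In the cyclic sum the first-order terms in `W` cancel. The symmetric polynomial of `𝔐` contains
one more `-2 t_i t_j` than each pair provides; the compensating `2 t_i t_j ∂_i ∂_j` are left for
`𝔇²`. -/
theorem adjacent_sum {i j k : Fin 6} (hij : i ≠ j) (hik : i ≠ k) (hjk : j ≠ k) :
    pd i (pd j (genFree (adjacentShift i j k modularGraphFn)))
      + pd j (pd k (genFree (adjacentShift j k i modularGraphFn)))
      + pd k (pd i (genFree (adjacentShift k i j modularGraphFn))) =
    ((t i ^ 2 + t j ^ 2 + t k ^ 2 - 2 * t i * t j - 2 * t j * t k - 2 * t k * t i) *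
      (pd i * pd j + pd j * pd k + pd k * pd i) : Op) W
      - ((pd j + pd k + (2 * t j + 2 * t k - t i) * (pd j * pd k) : Op) (W₁ i 0)
        + (pd k + pd i + (2 * t k + 2 * t i - t j) * (pd k * pd i) : Op) (W₁ j 0)
        + (pd i + pd j + (2 * t i + 2 * t j - t k) * (pd i * pd j) : Op) (W₁ k 0))
      + (2 * X i * X j * pd i (pd j W) + 2 * X j * X k * pd j (pd k W)
        + 2 * X k * X i * pd k (pd i W))
      + (pd i (pd j (W₁ k (-1))) + pd j (pd k (W₁ i (-1))) + pd k (pd i (W₁ j (-1)))) := by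
  rw [pd_pd_adjacentShift hij hik hjk, pd_pd_adjacentShift hjk hij.symm hik.symm,
    pd_pd_adjacentShift hik.symm hjk.symm hij]
  simp only [← W_eq, ← W₁_eq, LinearMap.add_apply, LinearMap.sub_apply, Module.End.mul_apply,
    t_sq_apply, t_apply, op_two]
  ring

theorem vertex_sum :
    ∑ v, ∑ b : Fin 3, pd (vertexEdges v b) (pd (vertexEdges v (b + 1)) (genFree
        (adjacentShift (vertexEdges v b) (vertexEdges v (b + 1)) (vertexEdges v (b + 2))
          modularGraphFn))) =
      adjacentPart W + remainderAdjacent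
        + ∑ v, ∑ b : Fin 3, 2 * X (vertexEdges v b) * X (vertexEdges v (b + 1)) *
            pd (vertexEdges v b) (pd (vertexEdges v (b + 1)) W)
        + ∑ v, ∑ b : Fin 3, pd (vertexEdges v b) (pd (vertexEdges v (b + 1))
            (W₁ (vertexEdges v (b + 2)) (-1))) := by
  have hne : ∀ v, vertexEdges v 0 ≠ vertexEdges v 1 ∧ vertexEdges v 0 ≠ vertexEdges v 2 ∧
      vertexEdges v 1 ≠ vertexEdges v 2 := by decide
  simp only [adjacentPart, remainderAdjacent, LinearMap.sum_apply, ← sub_eq_add_neg,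
    ← Finset.sum_sub_distrib, ← Finset.sum_add_distrib]
  refine Finset.sum_congr rfl fun v _ => ?_
  simp only [Fin.sum_univ_three]
  exact adjacent_sum (hne v).1 (hne v).2.1 (hne v).2.2

theorem opposite_sum_aux {i o a b c d : Fin 6} (hnd : [i, o, a, b, c, d].Nodup) :
    pd i (pd o (genFree (oppositeShift i o a b c d modularGraphFn))) =
      (((t a - t b + t c - t d) ^ 2 - 4 * t i * t o) * (pd i * pd o) : Op) W
      + (2 * (pd i * pd o) : Op) (W₀₀ a c + W₀₀ b d - W₀₀ a b - W₀₀ a d - W₀₀ b c - W₀₀ c d)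
      + (((t a + 2 * t c - 2 * t b - 2 * t d) * (pd i * pd o) : Op) (W₁ a 0)
        + ((t b + 2 * t d - 2 * t a - 2 * t c) * (pd i * pd o) : Op) (W₁ b 0)
        + ((t c + 2 * t a - 2 * t b - 2 * t d) * (pd i * pd o) : Op) (W₁ c 0)
        + ((t d + 2 * t b - 2 * t a - 2 * t c) * (pd i * pd o) : Op) (W₁ d 0))
      + (2 * X i * X o * pd i (pd o W) - 2 * X i * pd i W - 2 * X o * pd o W - 2 * W)
      + (pd i (pd o (W₁ a (-1))) + pd i (pd o (W₁ b (-1))) + pd i (pd o (W₁ c (-1)))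
        + pd i (pd o (W₁ d (-1)))) := by
  rw [pd_pd_oppositeShift hnd]
  simp only [← W_eq, ← W₁_eq, ← W₀₀_eq, LinearMap.add_apply, LinearMap.sub_apply,
    Module.End.mul_apply, sq, t_apply, op_two, op_four, map_add, map_sub]
  ring

theorem opposite_sum :
    ∑ i ∈ ({0, 1, 2} : Finset (Fin 6)), pd i (pd (i + 3) (genFree
        (oppositeShift i (i + 3) (i + 1) (i + 2) (i + 4) (i + 5) modularGraphFn))) =
      oppositePart W + remainderTwoZero + remainderOpposite
        + ∑ i ∈ ({0, 1, 2} : Finset (Fin 6)), (2 * X i * X (i + 3) * pd i (pd (i + 3) W)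
          - 2 * X i * pd i W - 2 * X (i + 3) * pd (i + 3) W - 2 * W)
        + ∑ i ∈ ({0, 1, 2} : Finset (Fin 6)), (pd i (pd (i + 3) (W₁ (i + 1) (-1)))
          + pd i (pd (i + 3) (W₁ (i + 2) (-1))) + pd i (pd (i + 3) (W₁ (i + 4) (-1)))
          + pd i (pd (i + 3) (W₁ (i + 5) (-1)))) := by
  have hnd : ∀ i : Fin 6, [i, i + 3, i + 1, i + 2, i + 4, i + 5].Nodup := by decide
  have hR : remainderOpposite = ∑ i ∈ ({0, 1, 2} : Finset (Fin 6)),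
      (((t (i + 1) + 2 * t (i + 4) - 2 * t (i + 2) - 2 * t (i + 5)) * (pd i * pd (i + 3)) : Op)
          (W₁ (i + 1) 0)
        + ((t (i + 2) + 2 * t (i + 5) - 2 * t (i + 1) - 2 * t (i + 4)) * (pd i * pd (i + 3)) : Op)
          (W₁ (i + 2) 0)
        + ((t (i + 4) + 2 * t (i + 1) - 2 * t (i + 2) - 2 * t (i + 5)) * (pd i * pd (i + 3)) : Op)
          (W₁ (i + 4) 0)
        + ((t (i + 5) + 2 * t (i + 2) - 2 * t (i + 1) - 2 * t (i + 4)) * (pd i * pd (i + 3)) : Op)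
          (W₁ (i + 5) 0)) := by
    rw [sum_fin_zero_one_two, remainderOpposite, Fin.sum_univ_six]
    simp only [LinearMap.add_apply, LinearMap.sub_apply, Module.End.mul_apply, t_apply, op_two,
      Fin.reduceAdd, zero_add, pd_comm 3 0, pd_comm 4 1, pd_comm 5 2]
    ring
  rw [hR, oppositePart, remainderTwoZero]
  simp only [LinearMap.sum_apply, ← Finset.sum_add_distrib]
  exact Finset.sum_congr rfl fun i _ => opposite_sum_aux (hnd i)

/-- Expanding `(∂_p + ∂_q)(∂_r + ∂_s)` gives four pairs: the two pairs that meet `i` at its ends,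
and two pairs of opposite edges. -/
theorem negOne_sum :
    ∑ v, ∑ b : Fin 3, pd (vertexEdges v b) (pd (vertexEdges v (b + 1))
        (W₁ (vertexEdges v (b + 2)) (-1)))
      + ∑ i ∈ ({0, 1, 2} : Finset (Fin 6)), (pd i (pd (i + 3) (W₁ (i + 1) (-1)))
          + pd i (pd (i + 3) (W₁ (i + 2) (-1))) + pd i (pd (i + 3) (W₁ (i + 4) (-1)))
          + pd i (pd (i + 3) (W₁ (i + 5) (-1)))) = remainderNegOne := by
  rw [sum_fin_zero_one_two, remainderNegOne]
  simp only [Fin.sum_univ_four, Fin.sum_univ_three, Fin.sum_univ_six, vertexEdges, trianglesAt,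
    Module.End.mul_apply, LinearMap.add_apply, map_add, Fin.reduceAdd, zero_add, Matrix.cons_val]
  simp only [pd_comm 2 0, pd_comm 5 0, pd_comm 4 1, pd_comm 5 1, pd_comm 4 2, pd_comm 5 2, pd_comm 4 3,
    pd_comm 5 3, pd_comm 5 4]
  abel

theorem euler_apply (f : Series) : euler f = ∑ i, X i * pd i f := by
  simp only [euler, LinearMap.sum_apply, Module.End.mul_apply, t_apply]

theorem euler_euler_apply (f : Series) :
    euler (euler f) = ∑ i, ∑ j, X i * X j * pd i (pd j f) + ∑ i, X i * pd i f := by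
  rw [euler_apply, euler_apply, ← Finset.sum_add_distrib]
  refine Finset.sum_congr rfl fun i _ => ?_
  rw [map_sum, Finset.mul_sum]
  simp only [pd_mul]
  have : ∀ j, X i * (X j * pd i (pd j f) + pd j f * pd i (X j)) =
      X i * X j * pd i (pd j f) + if j = i then X i * pd i f else 0 := fun j => by
    by_cases h : j = i
    · subst h; rw [pd_X_self, if_pos rfl]; ring
    · rw [pd_X_of_ne h, if_neg h]; ring
  simp only [this, Finset.sum_add_distrib, Finset.sum_ite_eq', Finset.mem_univ, if_true]

/-- The left-over quadratic terms assemble to `𝔇²`. The three opposite pairs contribute `-2 𝔇 - 6`,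
which accounts for the constant `6` in the Laplace equation. -/
theorem euler_sum (f : Series) :
    ∑ i, (X i ^ 2 * pd i (pd i f) + 2 * X i * pd i f)
      + ∑ v, ∑ b : Fin 3, 2 * X (vertexEdges v b) * X (vertexEdges v (b + 1)) *
            pd (vertexEdges v b) (pd (vertexEdges v (b + 1)) f)
      + ∑ i ∈ ({0, 1, 2} : Finset (Fin 6)), (2 * X i * X (i + 3) * pd i (pd (i + 3) f)
          - 2 * X i * pd i f - 2 * X (i + 3) * pd (i + 3) f - 2 * f) =
      (euler ^ 2 - euler - 6 : Op) f := by
  rw [sq, LinearMap.sub_apply, LinearMap.sub_apply, Module.End.mul_apply, euler_euler_apply,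
    euler_apply, op_six,
    sum_fin_zero_one_two]
  simp only [Fin.sum_univ_four, Fin.sum_univ_three, Fin.sum_univ_six, vertexEdges,
    Fin.reduceAdd, zero_add, Matrix.cons_val]
  simp only [pd_comm 1 0, pd_comm 2 0, pd_comm 3 0, pd_comm 4 0, pd_comm 5 0, pd_comm 2 1,
    pd_comm 3 1, pd_comm 4 1, pd_comm 5 1, pd_comm 3 2, pd_comm 4 2, pd_comm 5 2, pd_comm 4 3,
    pd_comm 5 3, pd_comm 5 4]
  ring

theorem lapSeries_modularGraphFn :
    lapSeries modularGraphFn = (euler ^ 2 - euler - 6 : Op) W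
      + (adjacentPart + oppositePart : Op) W + remainder := by
  rw [lapSeries, vertex_sum, opposite_sum, ← euler_sum, remainder, ← negOne_sum,
    LinearMap.add_apply]
  simp only [pd_diagonal, ← W_eq]
  abel

end

/-! ### The Casimir operator -/

section

open MvPowerSeries

theorem glAction_zero_right (a : Fin 3) (f : Series) :
    glAction a 0 f = twoT a 0 (pd 0 f) + (twoT a 0 (pd 2 f) + twoT a 1 (pd 2 f))
      + (twoT a 0 (pd 4 f) + twoT a 1 (pd 4 f) + twoT a 2 (pd 4 f)) := by
  simp [glAction, edgeVector, Fin.sum_univ_six, Fin.sum_univ_three]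

theorem glAction_one_right (a : Fin 3) (f : Series) :
    glAction a 1 f = twoT a 1 (pd 1 f) + (twoT a 0 (pd 2 f) + twoT a 1 (pd 2 f))
      + (twoT a 0 (pd 4 f) + twoT a 1 (pd 4 f) + twoT a 2 (pd 4 f))
      + (twoT a 1 (pd 5 f) + twoT a 2 (pd 5 f)) := by
  simp [glAction, edgeVector, Fin.sum_univ_six, Fin.sum_univ_three]

theorem glAction_two_right (a : Fin 3) (f : Series) :
    glAction a 2 f = twoT a 2 (pd 3 f)
      + (twoT a 0 (pd 4 f) + twoT a 1 (pd 4 f) + twoT a 2 (pd 4 f))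
      + (twoT a 1 (pd 5 f) + twoT a 2 (pd 5 f)) := by
  simp [glAction, edgeVector, Fin.sum_univ_six, Fin.sum_univ_three]

/-- The trace part acts as `T ↦ 2 T`, that is, as twice the degree. -/
theorem sum_glAction_self : ∑ c, glAction c c = 2 * euler := by
  refine LinearMap.ext fun f => ?_
  rw [Module.End.mul_apply, op_two, euler_apply, Fin.sum_univ_three, Fin.sum_univ_six]
  simp only [LinearMap.add_apply, glAction_zero_right, glAction_one_right, glAction_two_right]
  simp only [twoT, Matrix.of_apply, Matrix.cons_val, LinearMap.add_apply, LinearMap.sub_apply,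
    Module.End.mul_apply, t_apply, op_two]
  ring

set_option maxHeartbeats 4000000 in
theorem sum_glAction_mul :
    ∑ a, ∑ b, glAction a b * glAction b a
      = 4 * euler ^ 2 + 4 * euler + 2 * (adjacentPart + oppositePart) := by
  refine LinearMap.ext fun f => ?_
  simp only [Fin.sum_univ_three, LinearMap.add_apply, Module.End.mul_apply]
  simp only [glAction_zero_right, glAction_one_right, glAction_two_right]
  have h01 : ∀ i j : Fin 6, pd i (X j : Series) = if j = i then 1 else 0 := fun i j => by
    split_ifs with h
    · rw [h, pd_X_self]
    · exact pd_X_of_ne h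
  have he : (euler ^ 2 : Op) f = euler (euler f) := by rw [sq]; rfl
  simp only [op_four, op_two, he, euler_euler_apply]
  simp only [euler_apply]
  simp only [twoT, Matrix.of_apply, Matrix.cons_val, LinearMap.add_apply, LinearMap.sub_apply,
    Module.End.mul_apply, t_apply, op_four, map_add, map_sub, two_mul, pd_mul, h01,
    Fin.reduceEq, if_true, if_false, mul_one, mul_zero, add_zero, sq,
    Fin.sum_univ_six, adjacentPart, oppositePart, sum_fin_zero_one_two, LinearMap.sum_apply]
  simp only [Fin.sum_univ_four, vertexEdges, Fin.reduceAdd, zero_add, Matrix.cons_val]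
  simp only [pd_comm 1 0, pd_comm 2 0, pd_comm 3 0, pd_comm 4 0, pd_comm 5 0, pd_comm 2 1,
    pd_comm 3 1, pd_comm 4 1, pd_comm 5 1, pd_comm 3 2, pd_comm 4 2, pd_comm 5 2, pd_comm 4 3,
    pd_comm 5 3, pd_comm 5 4]
  -- With all variables on the left of ordered derivatives, both sides are linear in the derivatives
  -- of `f`; treating these as indeterminates leaves an identity in a commutative ring.
  generalize pd 0 (pd 0 f) = d00
  generalize pd 0 (pd 1 f) = d01
  generalize pd 0 (pd 2 f) = d02
  generalize pd 0 (pd 3 f) = d03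
  generalize pd 0 (pd 4 f) = d04
  generalize pd 0 (pd 5 f) = d05
  generalize pd 1 (pd 1 f) = d11
  generalize pd 1 (pd 2 f) = d12
  generalize pd 1 (pd 3 f) = d13
  generalize pd 1 (pd 4 f) = d14
  generalize pd 1 (pd 5 f) = d15
  generalize pd 2 (pd 2 f) = d22
  generalize pd 2 (pd 3 f) = d23
  generalize pd 2 (pd 4 f) = d24
  generalize pd 2 (pd 5 f) = d25
  generalize pd 3 (pd 3 f) = d33
  generalize pd 3 (pd 4 f) = d34
  generalize pd 3 (pd 5 f) = d35
  generalize pd 4 (pd 4 f) = d44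
  generalize pd 4 (pd 5 f) = d45
  generalize pd 5 (pd 5 f) = d55
  generalize pd 0 f = d0
  generalize pd 1 f = d1
  generalize pd 2 f = d2
  generalize pd 3 f = d3
  generalize pd 4 f = d4
  generalize pd 5 f = d5
  generalize (X 0 : Series) = x0
  generalize (X 1 : Series) = x1
  generalize (X 2 : Series) = x2
  generalize (X 3 : Series) = x3
  generalize (X 4 : Series) = x4
  generalize (X 5 : Series) = x5
  ring

end

/-! ### Convergence of the shifted sums -/

section

open MvPowerSeries

/-- Removing the trace subtracts `(1/3) (2 𝔇)²` from the `gl(3)` sum, so half of it is `2 𝔇² - (2/3)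
𝔇² + 2 𝔇 + 𝔐`. -/
theorem casimir_eq_slCasimir : casimir = slCasimir := by
  have h : ∑ a, ∑ b, slAction a b * slAction b a =
      ∑ a, ∑ b, glAction a b * glAction b a - (1 / 3 : ℝ) • (2 * euler) ^ 2 := by
    rw [← sum_glAction_self]
    simp only [slAction, Fin.sum_univ_three, Fin.reduceEq, if_true, if_false, sub_zero]
    simp only [sq, sub_mul, mul_sub, smul_add, add_mul, mul_add, smul_mul_assoc, mul_smul_comm]
    module
  have h2 : (2 * euler : Op) ^ 2 = (4 : ℝ) • euler ^ 2 := by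
    rw [two_mul, ← two_smul ℝ, smul_pow]; norm_num
  have h3 : ∀ A : Op, 2 * A = (2 : ℝ) • A := fun A => by rw [two_mul, two_smul]
  have h4 : ∀ A : Op, 4 * A = (4 : ℝ) • A := fun A => by
    rw [show (4 : Op) = 2 * 2 by norm_num, mul_assoc, h3, h3, smul_smul]; norm_num
  rw [slCasimir, h, sum_glAction_mul, h2, casimir]
  simp only [h3, h4]
  module

theorem laplace_casimir_form (f : Series) :
    casimir f - ((1 / 3 : ℝ) • ((euler + 3) * (euler + 6)) : Op) f =
      (euler ^ 2 - euler - 6 : Op) f + (adjacentPart + oppositePart : Op) f := by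
  rw [← LinearMap.sub_apply, ← LinearMap.add_apply]
  congr 1
  have h2 : ∀ A : Op, 2 * A = (2 : ℝ) • A := fun A => by rw [two_mul, two_smul]
  have h3 : (3 : Op) = (3 : ℝ) • 1 := by
    rw [show (3 : Op) = 2 * 1 + 1 by norm_num, h2]; module
  have h6 : (6 : Op) = (6 : ℝ) • 1 := by
    rw [show (6 : Op) = 2 * (2 * 1 + 1) by norm_num, h2, h2]; module
  rw [casimir, h2, h3, h6]
  simp only [add_mul, mul_add, smul_mul_assoc, mul_smul_comm, one_mul, mul_one, sq]
  module

/-! ### Exponents reached from those of `W` by two raisings and two lowerings -/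

theorem Occurs.of_one {s : Fin 6 → ℤ} (i : Fin 6) (hi : 0 ≤ s i) (h : ∀ j, j ≠ i → 1 ≤ s j) :
    Occurs s := by
  by_cases h0 : s i = 0
  · exact Or.inr (Or.inl ⟨i, h0, h⟩)
  · refine Or.inl fun j => ?_
    by_cases hj : j = i
    · subst hj; omega
    · exact h j hj

theorem Occurs.of_two {s : Fin 6 → ℤ} (i j k : Fin 6) (hjk : j ≠ k) (hj : 0 ≤ s j) (hk : 0 ≤ s k)
    (hi : 2 ≤ s i) (hi' : 2 ≤ s (i + 3)) (h : ∀ l, l ≠ j → l ≠ k → 1 ≤ s l) : Occurs s := by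
  by_cases h0 : s j = 0
  · by_cases h1 : s k = 0
    · exact Or.inr (Or.inr (Or.inl ⟨i, j, k, hjk, h0, h1, hi, hi', h⟩))
    · refine Occurs.of_one j hj fun l hl => ?_
      by_cases hlk : l = k
      · subst hlk; omega
      · exact h l hl hlk
  · refine Occurs.of_one k hk fun l hl => ?_
    by_cases hlj : l = j
    · subst hlj; omega
    · exact h l hlj hl

theorem Occurs.of_negOne {s : Fin 6 → ℤ} (i : Fin 6) (hi : -1 ≤ s i) (h : ∀ j, j ≠ i → 1 ≤ s j)
    (h1 : 2 ≤ s (trianglesAt i).1.1 ∨ 2 ≤ s (trianglesAt i).1.2)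
    (h2 : 2 ≤ s (trianglesAt i).2.1 ∨ 2 ≤ s (trianglesAt i).2.2) : Occurs s := by
  by_cases h0 : s i = -1
  · exact Or.inr (Or.inr (Or.inr ⟨i, h0, h, h1, h2⟩))
  · exact Occurs.of_one i (by omega) h

/-- The lattice summand as a function of the exponents and of `τ`. -/
def summand (k : LoopMomenta) : Coeffs := fun s τ => latticeTerm s τ k

theorem Occurs.hasSum {s : Fin 6 → ℤ} (h : Occurs s) (τ : ℍ) :
    HasSum (fun k => summand k s τ) (modularGraphFn s τ) :=
  (h.summable_latticeTerm τ).hasSum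

theorem lower_lower_apply (i j : Fin 6) (a : Coeffs) (s : Fin 6 → ℤ) :
    (lower i * lower j) a s = a (s - Pi.single i 1 - Pi.single j 1) := rfl

/-- The exponents `s` with one propagator more on each of the edges `i` and `j`. -/
def raise (i j : Fin 6) (s : Fin 6 → ℤ) : Fin 6 → ℤ := s + Pi.single i 1 + Pi.single j 1

theorem raise_sub_apply (i j a b : Fin 6) (s : Fin 6 → ℤ) (l : Fin 6) :
    (raise i j s - Pi.single a 1 - Pi.single b 1 : Fin 6 → ℤ) l = s l + (if l = i then 1 else 0)
      + (if l = j then 1 else 0) - (if l = a then 1 else 0) - (if l = b then 1 else 0) := by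
  simp only [raise, Pi.sub_apply, Pi.add_apply, Pi.single_apply]

/-- Every shifted exponent vector must occur separately for the sum to be split. The critical one
lowers `k` twice, possibly to `-1`; then the raised edges `i` and `j` lie in different triangles at
`k` and have exponent at least `2`. -/
theorem hasSum_adjacentShift {i j k : Fin 6} (hij : i ≠ j) (hik : i ≠ k) (hjk : j ≠ k)
    (htri : (i = (trianglesAt k).1.1 ∨ i = (trianglesAt k).1.2) ∧
        (j = (trianglesAt k).2.1 ∨ j = (trianglesAt k).2.2) ∨
      (j = (trianglesAt k).1.1 ∨ j = (trianglesAt k).1.2) ∧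
        (i = (trianglesAt k).2.1 ∨ i = (trianglesAt k).2.2))
    {s : Fin 6 → ℤ} (hs : ∀ j, 1 ≤ s j) (τ : ℍ) :
    HasSum (fun q => adjacentShift i j k (summand q) (raise i j s) τ)
      (adjacentShift i j k modularGraphFn (raise i j s) τ) := by
  have o1 : Occurs (raise i j s - Pi.single i 1 - Pi.single i 1) := by
    refine Occurs.of_one i ?_ fun l hl => ?_ <;> rw [raise_sub_apply]
    · have := hs i; grind
    · have := hs l; grind
  have o2 : Occurs (raise i j s - Pi.single j 1 - Pi.single j 1) := by
    refine Occurs.of_one j ?_ fun l hl => ?_ <;> rw [raise_sub_apply]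
    · have := hs j; grind
    · have := hs l; grind
  have o3 : Occurs (raise i j s - Pi.single k 1 - Pi.single k 1) := by
    have hi : 2 ≤ (raise i j s - Pi.single k 1 - Pi.single k 1 : Fin 6 → ℤ) i := by
      rw [raise_sub_apply]; have := hs i; grind
    have hj : 2 ≤ (raise i j s - Pi.single k 1 - Pi.single k 1 : Fin 6 → ℤ) j := by
      rw [raise_sub_apply]; have := hs j; grind
    refine Occurs.of_negOne k ?_ (fun l hl => ?_) ?_ ?_
    · rw [raise_sub_apply]; have := hs k; grind
    · rw [raise_sub_apply]; have := hs l; grind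
    · rcases htri with ⟨h | h, -⟩ | ⟨h | h, -⟩ <;> rw [← h] <;> tauto
    · rcases htri with ⟨-, h | h⟩ | ⟨-, h | h⟩ <;> rw [← h] <;> tauto
  have o4 : Occurs (raise i j s - Pi.single k 1 - Pi.single i 1) := by
    refine Occurs.of_one k ?_ fun l hl => ?_ <;> rw [raise_sub_apply]
    · have := hs k; grind
    · have := hs l; grind
  have o5 : Occurs (raise i j s - Pi.single k 1 - Pi.single j 1) := by
    refine Occurs.of_one k ?_ fun l hl => ?_ <;> rw [raise_sub_apply]
    · have := hs k; grind
    · have := hs l; grind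
  simp only [adjacentShift, LinearMap.add_apply, LinearMap.sub_apply, LinearMap.smul_apply,
    Pi.add_apply, Pi.sub_apply, Pi.smul_apply, lower_lower_apply]
  exact ((((o1.hasSum τ).add (o2.hasSum τ)).add (o3.hasSum τ)).sub ((o4.hasSum τ).const_smul 2)).sub
    ((o5.hasSum τ).const_smul 2)

/-- Raising the opposite pair `i`, `i + 3` provides exactly the two exponents `≥ 2` required when
`a` and `b` both drop to `0`. -/
theorem occurs_opposite {i a b : Fin 6} (hab : a ≠ b) (hai : a ≠ i) (hao : a ≠ i + 3)
    (hbi : b ≠ i) (hbo : b ≠ i + 3) {s : Fin 6 → ℤ} (hs : ∀ j, 1 ≤ s j) :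
    Occurs (raise i (i + 3) s - Pi.single a 1 - Pi.single b 1) := by
  refine Occurs.of_two i a b hab ?_ ?_ ?_ ?_ fun l hla hlb => ?_ <;> rw [raise_sub_apply]
  · have := hs a; grind
  · have := hs b; grind
  · have := hs i; grind
  · have := hs (i + 3); grind
  · have := hs l; grind

theorem occurs_opposite_self {i a : Fin 6} (hai : a ≠ i) (hao : a ≠ i + 3) {s : Fin 6 → ℤ}
    (hs : ∀ j, 1 ≤ s j) : Occurs (raise i (i + 3) s - Pi.single a 1 - Pi.single a 1) := by
  have htri : ∀ i a : Fin 6, a ≠ i → a ≠ i + 3 →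
      (i = (trianglesAt a).1.1 ∨ i = (trianglesAt a).1.2) ∧
        (i + 3 = (trianglesAt a).2.1 ∨ i + 3 = (trianglesAt a).2.2) ∨
      (i + 3 = (trianglesAt a).1.1 ∨ i + 3 = (trianglesAt a).1.2) ∧
        (i = (trianglesAt a).2.1 ∨ i = (trianglesAt a).2.2) := by decide
  have hi : 2 ≤ (raise i (i + 3) s - Pi.single a 1 - Pi.single a 1 : Fin 6 → ℤ) i := by
    rw [raise_sub_apply]; have := hs i; grind
  have hj : 2 ≤ (raise i (i + 3) s - Pi.single a 1 - Pi.single a 1 : Fin 6 → ℤ) (i + 3) := by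
    rw [raise_sub_apply]; have := hs (i + 3); grind
  refine Occurs.of_negOne a ?_ (fun l hl => ?_) ?_ ?_
  · rw [raise_sub_apply]; have := hs a; grind
  · rw [raise_sub_apply]; have := hs l; grind
  · rcases htri i a hai hao with ⟨h | h, -⟩ | ⟨h | h, -⟩ <;> rw [← h] <;> tauto
  · rcases htri i a hai hao with ⟨-, h | h⟩ | ⟨-, h | h⟩ <;> rw [← h] <;> tauto

theorem hasSum_oppositeShift {i a b c d : Fin 6} (hnd : [i, i + 3, a, b, c, d].Nodup)
    {s : Fin 6 → ℤ} (hs : ∀ j, 1 ≤ s j) (τ : ℍ) :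
    HasSum (fun q => oppositeShift i (i + 3) a b c d (summand q) (raise i (i + 3) s) τ)
      (oppositeShift i (i + 3) a b c d modularGraphFn (raise i (i + 3) s) τ) := by
  simp only [List.nodup_cons, List.mem_cons, not_or, List.not_mem_nil, not_false_eq_true,
    List.nodup_nil, and_true] at hnd
  obtain ⟨⟨-, hia, hib, hic, hid⟩, ⟨hoa, hob, hoc, hod⟩, ⟨hab, hac, had⟩, ⟨hbc, hbd⟩, hcd⟩ := hnd
  have o0 : Occurs (raise i (i + 3) s - Pi.single i 1 - Pi.single (i + 3) 1) := by
    refine Or.inl fun l => ?_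
    rw [raise_sub_apply]
    have := hs l
    split_ifs <;> omega
  simp only [← ne_eq] at *
  simp only [oppositeShift, LinearMap.add_apply, LinearMap.sub_apply, LinearMap.smul_apply,
    Pi.add_apply, Pi.sub_apply, Pi.smul_apply, lower_lower_apply]
  exact ((((((((((occurs_opposite_self hia.symm hoa.symm hs).hasSum τ).add
    ((occurs_opposite_self hib.symm hob.symm hs).hasSum τ)).add
    ((occurs_opposite_self hic.symm hoc.symm hs).hasSum τ)).add
    ((occurs_opposite_self hid.symm hod.symm hs).hasSum τ)).add
    (((occurs_opposite hac hia.symm hoa.symm hic.symm hoc.symm hs).hasSum τ).const_smul 2)).add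
    (((occurs_opposite hbd hib.symm hob.symm hid.symm hod.symm hs).hasSum τ).const_smul 2)).sub
    (((occurs_opposite hab hia.symm hoa.symm hib.symm hob.symm hs).hasSum τ).const_smul 2)).sub
    (((occurs_opposite had hia.symm hoa.symm hid.symm hod.symm hs).hasSum τ).const_smul 2)).sub
    (((occurs_opposite hbc hib.symm hob.symm hic.symm hoc.symm hs).hasSum τ).const_smul 2)).sub
    (((occurs_opposite hcd hic.symm hoc.symm hid.symm hod.symm hs).hasSum τ).const_smul 2) |>.sub
    ((o0.hasSum τ).const_smul 2)

end

/-! ### The Laplace equation -/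

section

open MvPowerSeries

theorem invPropagator_add (p q : ℝ × ℝ) (z : ℂ) :
    invPropagator (p + q) z = invPropagator p z + invPropagator q z + 2 * pairing p q z := by
  simp only [invPropagator, pairing, Prod.fst_add, Prod.snd_add]
  ring

theorem invPropagator_sub (p q : ℝ × ℝ) (z : ℂ) :
    invPropagator (p - q) z = invPropagator p z + invPropagator q z - 2 * pairing p q z := by
  simp only [invPropagator, pairing, Prod.fst_sub, Prod.snd_sub]
  ring

theorem pairing_comm (p q : ℝ × ℝ) (z : ℂ) : pairing p q z = pairing q p z := by
  simp only [pairing]; ring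

theorem gradPairing_comm (p q : ℝ × ℝ) (z : ℂ) : gradPairing p q z = gradPairing q p z := by
  rw [gradPairing, gradPairing, pairing_comm, mul_comm (invPropagator p z)]

theorem gradPairing_self (p : ℝ × ℝ) (z : ℂ) : gradPairing p p z = invPropagator p z ^ 2 := by
  simp only [gradPairing, pairing, invPropagator]
  ring

/-- By conservation and polarization, `2 pairing` equals `±(X_k - X_i - X_j)` for the third edge `k`
at the vertex; the sign disappears in the square. -/
theorem two_mul_gradPairing_vertex (k : LoopMomenta) (v : Fin 4) (b : Fin 3) (z : ℂ) :
    2 * gradPairing (realMomentum k (vertexEdges v b)) (realMomentum k (vertexEdges v (b + 1))) z =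
      invPropagator (realMomentum k (vertexEdges v b)) z ^ 2
        + invPropagator (realMomentum k (vertexEdges v (b + 1))) z ^ 2
        + invPropagator (realMomentum k (vertexEdges v (b + 2))) z ^ 2
        - 2 * (invPropagator (realMomentum k (vertexEdges v (b + 2))) z
          * invPropagator (realMomentum k (vertexEdges v b)) z)
        - 2 * (invPropagator (realMomentum k (vertexEdges v (b + 2))) z
          * invPropagator (realMomentum k (vertexEdges v (b + 1))) z) := by
  have key : ∀ x y w : ℝ × ℝ, (w = x + y ∨ w = x - y ∨ w = y - x) →
      2 * gradPairing x y z = invPropagator x z ^ 2 + invPropagator y z ^ 2 + invPropagator w z ^ 2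
        - 2 * (invPropagator w z * invPropagator x z)
        - 2 * (invPropagator w z * invPropagator y z) := by
    rintro x y w (rfl | rfl | rfl)
    · rw [invPropagator_add, gradPairing]; ring
    · rw [invPropagator_sub, gradPairing]; ring
    · rw [invPropagator_sub, gradPairing, pairing_comm]; ring
  apply key
  fin_cases v <;> fin_cases b <;>
    simp [vertexEdges, realMomentum, edgeMomentum, Prod.ext_iff] <;> grind

/-- The pairing of two opposite momenta is, up to sign, half the alternating sum of `X` around the
quadrilateral of the other four edges. -/
theorem two_mul_gradPairing_opposite (k : LoopMomenta) {i : Fin 6}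
    (hi : i ∈ ({0, 1, 2} : Finset (Fin 6))) (z : ℂ) :
    2 * gradPairing (realMomentum k i) (realMomentum k (i + 3)) z =
      (invPropagator (realMomentum k (i + 1)) z - invPropagator (realMomentum k (i + 2)) z
        + invPropagator (realMomentum k (i + 4)) z - invPropagator (realMomentum k (i + 5)) z) ^ 2
      - 2 * (invPropagator (realMomentum k i) z * invPropagator (realMomentum k (i + 3)) z) := by
  have key : (2 * pairing (realMomentum k i) (realMomentum k (i + 3)) z) ^ 2 =
      (invPropagator (realMomentum k (i + 1)) z - invPropagator (realMomentum k (i + 2)) z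
        + invPropagator (realMomentum k (i + 4)) z
        - invPropagator (realMomentum k (i + 5)) z) ^ 2 := by
    simp only [Finset.mem_insert, Finset.mem_singleton] at hi
    rcases hi with rfl | rfl | rfl <;>
      simp only [Fin.reduceAdd, zero_add, realMomentum, edgeMomentum, invPropagator, pairing,
        Matrix.cons_val, Prod.fst_add, Prod.snd_add] <;> push_cast <;> ring
  rw [← key, gradPairing]
  ring

/-- The inverse propagators of a configuration of loop momenta. -/
def invProp (k : LoopMomenta) (τ : ℍ) (i : Fin 6) : ℝ := invPropagator (realMomentum k i) τ

theorem invProp_pos (k : LoopMomenta) (τ : ℍ) (i : Fin 6) : 0 < invProp k τ i :=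
  invPropagator_pos (realMomentum_ne_zero k i) τ.im_pos

theorem summand_sub_single (k : LoopMomenta) (s : Fin 6 → ℤ) (i : Fin 6) (τ : ℍ) :
    summand k (s - Pi.single i 1) τ = invProp k τ i * summand k s τ := by
  have h : invProp k τ i = ∏ j, if j = i then invProp k τ i else 1 := by
    rw [Finset.prod_ite_eq' Finset.univ i, if_pos (Finset.mem_univ i)]
  rw [h, summand, summand, latticeTerm_eq, latticeTerm_eq, realTerm, realTerm,
    ← Finset.prod_mul_distrib]
  refine Finset.prod_congr rfl fun j _ => ?_
  have hj := (invProp_pos k τ j).ne'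
  rw [invProp] at hj
  rw [Pi.sub_apply, Pi.single_apply]
  split_ifs with h
  · subst h
    rw [show -(s j - 1) = -s j + 1 by ring, zpow_add_one₀ hj, mul_comm]
    rfl
  · rw [sub_zero, one_mul]

theorem summand_eq_mul_raise (k : LoopMomenta) (s : Fin 6 → ℤ) (i j : Fin 6) (τ : ℍ) :
    summand k s τ = invProp k τ i * invProp k τ j * summand k (raise i j s) τ := by
  rw [mul_assoc, ← summand_sub_single, ← summand_sub_single]
  congr 1
  rw [raise]
  abel

theorem lower_lower_summand (i j : Fin 6) (k : LoopMomenta) (s : Fin 6 → ℤ) (τ : ℍ) :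
    (lower i * lower j) (summand k) s τ = invProp k τ i * invProp k τ j * summand k s τ := by
  rw [lower_lower_apply, summand_sub_single, summand_sub_single]
  ring

theorem adjacentShift_summand (k : LoopMomenta) (v : Fin 4) (b : Fin 3) (s : Fin 6 → ℤ) (τ : ℍ) :
    adjacentShift (vertexEdges v b) (vertexEdges v (b + 1)) (vertexEdges v (b + 2)) (summand k)
        (raise (vertexEdges v b) (vertexEdges v (b + 1)) s) τ =
      2 * (gradPairing (realMomentum k (vertexEdges v b)) (realMomentum k (vertexEdges v (b + 1))) τ
        / (invPropagator (realMomentum k (vertexEdges v b)) τ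
          * invPropagator (realMomentum k (vertexEdges v (b + 1))) τ)) * summand k s τ := by
  have h := two_mul_gradPairing_vertex k v b (τ : ℂ)
  have h1 := (invProp_pos k τ (vertexEdges v b)).ne'
  have h2 := (invProp_pos k τ (vertexEdges v (b + 1))).ne'
  rw [← mul_div_assoc, h,
    summand_eq_mul_raise k s (vertexEdges v b) (vertexEdges v (b + 1)) τ]
  simp only [← invProp.eq_1] at h1 h2 ⊢
  simp only [adjacentShift, LinearMap.add_apply, LinearMap.sub_apply, LinearMap.smul_apply,
    Pi.add_apply, Pi.sub_apply, Pi.smul_apply, lower_lower_summand]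
  field_simp
  simp only [nsmul_eq_mul]
  push_cast
  ring

theorem oppositeShift_summand (k : LoopMomenta) {i : Fin 6}
    (hi : i ∈ ({0, 1, 2} : Finset (Fin 6))) (s : Fin 6 → ℤ) (τ : ℍ) :
    oppositeShift i (i + 3) (i + 1) (i + 2) (i + 4) (i + 5) (summand k) (raise i (i + 3) s) τ =
      2 * (gradPairing (realMomentum k i) (realMomentum k (i + 3)) τ
        / (invPropagator (realMomentum k i) τ * invPropagator (realMomentum k (i + 3)) τ))
        * summand k s τ := by
  have h := two_mul_gradPairing_opposite k hi (τ : ℂ)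
  have h1 := (invProp_pos k τ i).ne'
  have h2 := (invProp_pos k τ (i + 3)).ne'
  rw [← mul_div_assoc, h, summand_eq_mul_raise k s i (i + 3) τ]
  simp only [← invProp.eq_1] at h1 h2 ⊢
  simp only [oppositeShift, LinearMap.add_apply, LinearMap.sub_apply, LinearMap.smul_apply,
    Pi.add_apply, Pi.sub_apply, Pi.smul_apply, lower_lower_summand]
  field_simp
  simp only [nsmul_eq_mul]
  push_cast
  ring

/-- Two distinct edges either share exactly one vertex or are opposite: the `15` pairs split as `12
+ 3`. -/
theorem sum_sum_eq_of_symm (M : Fin 6 → Fin 6 → ℝ) (h : ∀ i j, M i j = M j i) :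
    ∑ i, ∑ j, M i j = ∑ i, M i i
      + ∑ v, ∑ b : Fin 3, 2 * M (vertexEdges v b) (vertexEdges v (b + 1))
      + ∑ i ∈ ({0, 1, 2} : Finset (Fin 6)), 2 * M i (i + 3) := by
  rw [Finset.sum_insert (by decide), Finset.sum_insert (by decide), Finset.sum_singleton]
  simp only [Fin.sum_univ_four, Fin.sum_univ_three, Fin.sum_univ_six, vertexEdges,
    Fin.reduceAdd, zero_add, Matrix.cons_val]
  rw [h 1 0, h 2 0, h 3 0, h 4 0, h 5 0, h 2 1, h 3 1, h 4 1, h 5 1, h 3 2, h 4 2, h 5 2, h 4 3,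
    h 5 3, h 5 4]
  ring

/-- The exponents belonging to a monomial. -/
def exponents (n : Fin 6 →₀ ℕ) : Fin 6 → ℤ := fun j => n j + 1

theorem one_le_exponents (n : Fin 6 →₀ ℕ) (j : Fin 6) : 1 ≤ exponents n j := by
  simp [exponents]

theorem coeff_genFree (a : Coeffs) (n : Fin 6 →₀ ℕ) (τ : ℍ) :
    coeff n (genFree a) τ = a (exponents n) τ := by
  rw [coeff_gen, if_pos fun j h => absurd rfl h]
  rfl

theorem exponents_add_single (n : Fin 6 →₀ ℕ) (i j : Fin 6) :
    exponents (n + Finsupp.single i 1 + Finsupp.single j 1) = raise i j (exponents n) := by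
  ext l
  simp only [exponents, raise, Finsupp.add_apply, Finsupp.single_apply, Pi.add_apply,
    Pi.single_apply, eq_comm (a := l)]
  push_cast
  ring

/-- Since `t_j` has exponent `s_j - 1`, the derivatives produce the factor `s_i s_j` and raise both
exponents. -/
theorem coeff_pd_pd_genFree {i j : Fin 6} (h : i ≠ j) (a : Coeffs) (n : Fin 6 →₀ ℕ) (τ : ℍ) :
    coeff n (pd i (pd j (genFree a))) τ =
      a (raise i j (exponents n)) τ * (exponents n i * exponents n j) := by
  rw [coeff_pd, coeff_pd, coeff_genFree, exponents_add_single, Finsupp.add_apply,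
    Finsupp.single_eq_of_ne h.symm, exponents, exponents]
  push_cast; ring

theorem coeff_diagonal (i : Fin 6) (a : Coeffs) (n : Fin 6 →₀ ℕ) (τ : ℍ) :
    (coeff n (pd i (pd i (genFree ((lower i * lower i) a))) - 2 * pd i (genFree (lower i a))) :
      ℍ → ℝ) τ =
      a (exponents n) τ * (exponents n i ^ 2 - exponents n i) := by
  have h1 : raise i i (exponents n) - Pi.single i 1 - Pi.single i 1 = exponents n := by
    rw [raise]; abel
  have h2 : lower i a (exponents (n + Finsupp.single i 1)) τ = a (exponents n) τ := by
    change a (exponents (n + Finsupp.single i 1) - Pi.single i 1) τ = _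
    congr 1
    ext l
    simp only [exponents, Finsupp.add_apply, Finsupp.single_apply, Pi.sub_apply,
      Pi.single_apply, eq_comm (a := l)]
    push_cast
    ring
  rw [two_mul, map_sub, map_add, Pi.sub_apply, Pi.add_apply, coeff_pd, coeff_pd, coeff_pd,
    coeff_genFree, coeff_genFree, exponents_add_single, lower_lower_apply, h1, h2,
    Finsupp.add_apply, Finsupp.single_eq_same, exponents]
  push_cast; ring

theorem coeff_lapSeries (a : Coeffs) (n : Fin 6 →₀ ℕ) (τ : ℍ) :
    coeff n (lapSeries a) τ =
      ∑ i, a (exponents n) τ * ((exponents n i : ℝ) ^ 2 - exponents n i)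
      + ∑ v, ∑ b : Fin 3, adjacentShift (vertexEdges v b) (vertexEdges v (b + 1))
          (vertexEdges v (b + 2)) a (raise (vertexEdges v b) (vertexEdges v (b + 1)) (exponents n)) τ
          * ((exponents n (vertexEdges v b) : ℝ) * exponents n (vertexEdges v (b + 1)))
      + ∑ i ∈ ({0, 1, 2} : Finset (Fin 6)),
          oppositeShift i (i + 3) (i + 1) (i + 2) (i + 4) (i + 5) a
            (raise i (i + 3) (exponents n)) τ
          * ((exponents n i : ℝ) * exponents n (i + 3)) := by
  have h1 : ∀ v, ∀ b : Fin 3, vertexEdges v b ≠ vertexEdges v (b + 1) := by decide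
  have h2 : ∀ i : Fin 6, i ≠ i + 3 := by decide
  simp only [lapSeries, map_add, map_sum, Pi.add_apply, Finset.sum_apply, coeff_diagonal,
    coeff_pd_pd_genFree (h1 _ _), coeff_pd_pd_genFree (h2 _)]

/-- For a single configuration of momenta the formal operator is the true Laplacian: the raisings
divide by `X_i X_j`, and the shifts multiply by `2 G_ij`. -/
theorem coeff_lapSeries_summand (k : LoopMomenta) (n : Fin 6 →₀ ℕ) (τ : ℍ) :
    coeff n (lapSeries (summand k)) τ =
      τ.im ^ 2 * Laplacian.laplacian (realTerm (exponents n) (realMomentum k)) (τ : ℂ) := by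
  have hl := laplacian_realTerm (exponents n) (realMomentum_ne_zero k) (z := τ) τ.im_pos
  rw [← latticeTerm_eq] at hl
  rw [show τ.im = (τ : ℂ).im from rfl, hl, sum_sum_eq_of_symm _ fun i j => by
    rw [gradPairing_comm, mul_comm (invPropagator _ _), mul_comm (exponents n i : ℝ)],
    coeff_lapSeries]
  have hs : latticeTerm (exponents n) τ k = summand k (exponents n) τ := rfl
  rw [hs]
  have e1 : ∀ i, gradPairing (realMomentum k i) (realMomentum k i) τ /
      (invPropagator (realMomentum k i) τ * invPropagator (realMomentum k i) τ) = 1 := fun i => by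
    rw [gradPairing_self, sq, div_self]
    exact mul_ne_zero (invProp_pos k τ i).ne' (invProp_pos k τ i).ne'
  simp only [adjacentShift_summand, e1, mul_one]
  rw [Finset.sum_congr (s₁ := {0, 1, 2}) rfl fun i hi => by rw [oppositeShift_summand k hi]]
  rw [← Finset.mul_sum, Finset.sum_sub_distrib]
  simp only [mul_add, mul_sub, Finset.mul_sum]
  rw [add_sub_right_comm, add_sub_right_comm]
  congr 1
  · congr 1
    · simp only [sq]
    · refine Finset.sum_congr rfl fun v _ => Finset.sum_congr rfl fun b _ => ?_
      ring
  · refine Finset.sum_congr rfl fun i _ => ?_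
    ring

theorem hasSum_coeff_lapSeries (n : Fin 6 →₀ ℕ) (τ : ℍ) :
    HasSum (fun k => coeff n (lapSeries (summand k)) τ)
      (coeff n (lapSeries modularGraphFn) τ) := by
  have hs := one_le_exponents n
  have h1 : ∀ v, ∀ b : Fin 3, vertexEdges v b ≠ vertexEdges v (b + 1) ∧
      vertexEdges v b ≠ vertexEdges v (b + 2) ∧
      vertexEdges v (b + 1) ≠ vertexEdges v (b + 2) := by decide
  have h2 : ∀ v, ∀ b : Fin 3,
      (vertexEdges v b = (trianglesAt (vertexEdges v (b + 2))).1.1 ∨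
          vertexEdges v b = (trianglesAt (vertexEdges v (b + 2))).1.2) ∧
        (vertexEdges v (b + 1) = (trianglesAt (vertexEdges v (b + 2))).2.1 ∨
          vertexEdges v (b + 1) = (trianglesAt (vertexEdges v (b + 2))).2.2) ∨
      (vertexEdges v (b + 1) = (trianglesAt (vertexEdges v (b + 2))).1.1 ∨
          vertexEdges v (b + 1) = (trianglesAt (vertexEdges v (b + 2))).1.2) ∧
        (vertexEdges v b = (trianglesAt (vertexEdges v (b + 2))).2.1 ∨
          vertexEdges v b = (trianglesAt (vertexEdges v (b + 2))).2.2) := by decide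
  have hnd : ∀ i : Fin 6, [i, i + 3, i + 1, i + 2, i + 4, i + 5].Nodup := by decide
  have h0 : Occurs (exponents n) := Or.inl hs
  simp only [coeff_lapSeries]
  refine HasSum.add (HasSum.add ?_ ?_) ?_
  · exact hasSum_sum fun i _ => (h0.hasSum τ).mul_right _
  · exact hasSum_sum fun v _ => hasSum_sum fun b _ =>
      (hasSum_adjacentShift (h1 v b).1 (h1 v b).2.1 (h1 v b).2.2 (h2 v b) hs τ).mul_right _
  · exact hasSum_sum fun i _ => (hasSum_oppositeShift (hnd i) hs τ).mul_right _

theorem coeff_W (n : Fin 6 →₀ ℕ) : coeff n W = modularGraphFn (exponents n) := by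
  funext τ
  rw [W_eq, coeff_genFree]

/-- The same series of termwise Laplacians is summed in two ways, by differentiation under the sum
and by splitting into shifted sums; uniqueness of the limit gives equality. -/
theorem seriesLaplacian_W : seriesLaplacian W = lapSeries modularGraphFn := by
  ext n τ
  have h1 := hasSum_coeff_lapSeries n τ
  simp only [coeff_lapSeries_summand] at h1
  have h2 := Occurs.hasSum_hypLaplacian (Or.inl (one_le_exponents n)) τ
  change hypLaplacian (coeff n W) τ = _
  rw [coeff_W]
  exact h2.unique h1

end

end Tetra

end

theorem mainTheorem2 :
    (∀ (s : Fin 6 → ℤ) (τ : ℍ), Tetra.Occurs s → Summable (Tetra.latticeTerm s τ)) ∧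
    (∀ n : Fin 6 →₀ ℕ, ContDiffOn ℝ 2
      (MvPowerSeries.coeff n Tetra.W ∘ UpperHalfPlane.ofComplex) {z : ℂ | 0 < z.im}) ∧
    Tetra.casimir = Tetra.slCasimir ∧
    Tetra.seriesLaplacian Tetra.W
        - (Tetra.euler ^ 2 - Tetra.euler - 6 : Tetra.Op) Tetra.W
      = (Tetra.adjacentPart + Tetra.oppositePart : Tetra.Op) Tetra.W + Tetra.remainder ∧
    Tetra.seriesLaplacian Tetra.W - Tetra.casimir Tetra.W
        + ((1 / 3 : ℝ) • ((Tetra.euler + 3) * (Tetra.euler + 6)) : Tetra.Op) Tetra.W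
      = Tetra.remainder := by
  have h := Tetra.seriesLaplacian_W.trans Tetra.lapSeries_modularGraphFn
  refine ⟨fun s τ hs => hs.summable_latticeTerm τ, fun n z hz => ?_, Tetra.casimir_eq_slCasimir,
    ?_, ?_⟩
  · rw [Tetra.coeff_W]
    exact (Tetra.Occurs.contDiffAt_modularGraphFn (Or.inl (Tetra.one_le_exponents n))
      ⟨z, hz⟩).contDiffWithinAt
  · rw [h]; abel
  · rw [← Tetra.laplace_casimir_form] at h
    rw [h]; abel
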